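/- Let $k$ be an algebraically closed field. In $\mathbb{P}^2$ over $k$, with coordinates $[x:y:z]$, let $L_\infty=\{z=0\}$, $A=[0:0:1]$, and let $B$ be a smooth conic with center $A$, $F(x,y,z)=ax^2+bxy+cy^2-ez^2=0$ with $b^2-4ac\neq 0$ and $e\neq 0$ (for instance the circle $x^2+y^2=r^2z^2$, $r\neq 0$). Let $L_1,L_2$ be the lines joining $A$ to the two points of $B\cap L_\infty$. Let $W_B\subset\mathbb{P}^2\times\mathbb{P}^2$ be the incidence surface $F(zX-xZ,\,zY-yZ,\,zZ)=0$, $xY-yX=0$, with projections $\pi_1,\pi_2$. For a curve $C$ (a nonzero effective divisor of $\mathbb{P}^2$), the conchoid of $C$ is the cycle $\mathcal{C}_B(C)=\pi_{2*}\pi_1^*(C)$, and the proper conchoid $\mathcal{C}'_B(C)$ is the curve obtained from $\mathcal{C}_B(C)$ by removing the components $B$, $L_1$ and $L_2$ (with all their multiplicities). Assume that the characteristic of $k$ is $0$ or greater than $\max(2,\deg C)$; if it is $5$, assume also that $C\neq B+B_2$, where $B_2$ is the conic $ax^2+bxy+cy^2-4ez^2=0$. Proposition. If $C$ has at least two distinct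 irreducible components different from $L_1$ and $L_2$, then the proper conchoid $\mathcal{C}'_B(C)$ is reducible: it has at least two distinct irreducible components. -/

import Mathlib

open MvPolynomial

/-!
Homogeneous coordinates on the projective plane are indexed by `Fin 3`, the line at infinity is
`z = 0` (that is, `X 2 = 0`), and the fixed point `A` is `[0 : 0 : 1]`.
-/

/-- A prime divisor (reduced and irreducible curve) of the projective plane, given by its
homogeneous prime ideal, which is generated by an irreducible form. -/
@[ext]
structure PrimeCurve (k : Type*) [Field k] where
  ideal : Ideal (MvPolynomial (Fin 3) k)
  exists_form : ∃ (n : ℕ) (H : MvPolynomial (Fin 3) k),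
    H.IsHomogeneous n ∧ Irreducible H ∧ ideal = Ideal.span {H}

/-- The irreducible components of the plane curve `G = 0`. -/
def curveComponents {k : Type*} [Field k] (G : MvPolynomial (Fin 3) k) : Set (PrimeCurve k) :=
  {D | G ∈ D.ideal}

/-- The bihomogeneous ideal of the incidence surface `W_B` in the product of two projective
planes with coordinates `[x : y : z; X : Y : Z]`, where `B` is the curve `F = 0`. It is generated
by `F (z X - x Z, z Y - y Z, z Z)` and `x Y - y X`. -/
noncomputable def incidenceIdeal {k : Type*} [Field k] (F : MvPolynomial (Fin 3) k) :
    Ideal (MvPolynomial (Fin 3 ⊕ Fin 3) k) :=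
  let x : Fin 3 → MvPolynomial (Fin 3 ⊕ Fin 3) k := fun i => X (Sum.inl i)
  let y : Fin 3 → MvPolynomial (Fin 3 ⊕ Fin 3) k := fun i => X (Sum.inr i)
  Ideal.span
    {aeval ![x 2 * y 0 - x 0 * y 2, x 2 * y 1 - x 1 * y 2, x 2 * y 2] F,
      x 0 * y 1 - x 1 * y 0}

/-- The ideal of the subscheme `π₁⁻¹(C)` of `W_B`, where `C` is the curve `G = 0`. -/
noncomputable def pullbackIdeal {k : Type*} [Field k] (F G : MvPolynomial (Fin 3) k) :
    Ideal (MvPolynomial (Fin 3 ⊕ Fin 3) k) :=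
  incidenceIdeal F ⊔ Ideal.span {rename Sum.inl G}

/-- The irreducible components `V` of `π₁⁻¹(C)`, as prime ideals: the minimal primes of its ideal
which contain neither `(x, y, z)` nor `(X, Y, Z)`, so that they define a nonempty subvariety of
the product of the two planes (they are bihomogeneous because the ideal is). -/
def pullbackComponents {k : Type*} [Field k] (F G : MvPolynomial (Fin 3) k) :
    Set (Ideal (MvPolynomial (Fin 3 ⊕ Fin 3) k)) :=
  {𝔓 | 𝔓 ∈ (pullbackIdeal F G).minimalPrimes ∧
    (∃ i, X (Sum.inl i) ∉ 𝔓) ∧ (∃ i, X (Sum.inr i) ∉ 𝔓)}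

/-- The coefficient of the subvariety `V` with ideal `𝔓` in the divisor `π₁^*(C)` of `W_B`: the
length of the local ring of `W_B` at `V` modulo a local equation of `C`. The ordinary
localization at `𝔓` may be used here in place of its part of bidegree `(0, 0)`: it is flat and
local over that part and the extended maximal ideal is maximal, so that lengths are the same. -/
noncomputable def pullbackMultiplicity {k : Type*} [Field k] (F G : MvPolynomial (Fin 3) k)
    (𝔓 : Ideal (MvPolynomial (Fin 3 ⊕ Fin 3) k)) [𝔓.IsPrime] : ℕ∞ :=
  Module.length (Localization.AtPrime 𝔓)
    (Localization.AtPrime 𝔓 ⧸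
      (pullbackIdeal F G).map (algebraMap _ (Localization.AtPrime 𝔓)))

/-- The function field `k(V)` of the subvariety `V` of the product of two planes with bihomogeneous
prime ideal `𝔓`, inside the fraction field of the bihomogeneous coordinate ring of `V`: it is
generated by the ratios of coordinates `xᵢ / xⱼ` and `Xᵢ / Xⱼ` (for the `j` such that the
denominator does not vanish on `V`; the other ratios are `0` in Lean). -/
noncomputable def functionField {k : Type*} [Field k]
    (𝔓 : Ideal (MvPolynomial (Fin 3 ⊕ Fin 3) k)) [𝔓.IsPrime] :
    IntermediateField k 𝔓.ResidueField :=
  let ξ : Fin 3 ⊕ Fin 3 → 𝔓.ResidueField := fun s =>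
    algebraMap (MvPolynomial (Fin 3 ⊕ Fin 3) k) 𝔓.ResidueField (X s)
  IntermediateField.adjoin k
    ({f | ∃ i j, f = ξ (Sum.inl i) / ξ (Sum.inl j)} ∪
      {f | ∃ i j, f = ξ (Sum.inr i) / ξ (Sum.inr j)})

/-- The function field of the image `π₂(V)`, as a subfield of `k(V)`. -/
noncomputable def imageFunctionField {k : Type*} [Field k]
    (𝔓 : Ideal (MvPolynomial (Fin 3 ⊕ Fin 3) k)) [𝔓.IsPrime] :
    IntermediateField k 𝔓.ResidueField :=
  let ξ : Fin 3 ⊕ Fin 3 → 𝔓.ResidueField := fun s =>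
    algebraMap (MvPolynomial (Fin 3 ⊕ Fin 3) k) 𝔓.ResidueField (X s)
  IntermediateField.adjoin k {f | ∃ i j, f = ξ (Sum.inr i) / ξ (Sum.inr j)}

/-- The degree `[k(V) : k(π₂(V))]` of the restriction of `π₂` to `V`. It is `0` if the extension is
infinite, in accordance with the definition of the push-forward. -/
noncomputable def pushDegree {k : Type*} [Field k]
    (𝔓 : Ideal (MvPolynomial (Fin 3 ⊕ Fin 3) k)) [𝔓.IsPrime] : ℕ :=
  (imageFunctionField 𝔓).relfinrank (functionField 𝔓)

open Classical in
/-- The contribution of the component `V` of `π₁⁻¹(C)` to the coefficient of `D` in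
`π₂_*(π₁^*(C))`: it is nonzero only if `π₂(V) = D`, that is, if the forms in `X, Y, Z` that vanish
on `V` are those that vanish on `D`. -/
noncomputable def conchoidContribution {k : Type*} [Field k] (F G : MvPolynomial (Fin 3) k)
    (D : PrimeCurve k) (𝔓 : Ideal (MvPolynomial (Fin 3 ⊕ Fin 3) k)) [𝔓.IsPrime] : ℕ∞ :=
  if 𝔓.comap (rename Sum.inr : MvPolynomial (Fin 3) k →ₐ[k] MvPolynomial (Fin 3 ⊕ Fin 3) k) =
      D.ideal
  then pullbackMultiplicity F G 𝔓 * (pushDegree 𝔓 : ℕ∞) else 0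

/-- The conchoid of `C` with respect to `B`, that is, the cycle `π₂_*(π₁^*(C))`, where `B` and `C`
are the curves `F = 0` and `G = 0`. A cycle is given by its coefficients. The sum is finite, as an
ideal of a polynomial ring has finitely many minimal primes. -/
noncomputable def conchoid {k : Type*} [Field k] (F G : MvPolynomial (Fin 3) k)
    (D : PrimeCurve k) : ℕ∞ :=
  ∑ᶠ V : pullbackComponents F G,
    haveI : V.1.IsPrime := V.2.1.1.1
    conchoidContribution F G D V.1

/-- The lines `L_i`, joining `A` to the points `[α : β : 0]` of `B` on the line at infinity. -/
def IsAsymptoticLine {k : Type*} [Field k] (F : MvPolynomial (Fin 3) k) (D : PrimeCurve k) :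
    Prop :=
  ∃ α β : k, (α ≠ 0 ∨ β ≠ 0) ∧ eval ![α, β, 0] F = 0 ∧
    D.ideal = Ideal.span {C β * X 0 - C α * X 1}

open Classical in
/-- The proper conchoid of `C` with respect to `B`: the conchoid with the components `B` and `L_i`
removed. -/
noncomputable def properConchoid {k : Type*} [Field k] (F G : MvPolynomial (Fin 3) k)
    (D : PrimeCurve k) : ℕ∞ :=
  if D.ideal = Ideal.span {F} ∨ IsAsymptoticLine F D then 0 else conchoid F G D

/-- The components of a cycle: the prime divisors with nonzero coefficient. -/
def cycleComponents {k : Type*} [Field k] (Z : PrimeCurve k → ℕ∞) : Set (PrimeCurve k) :=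
  {D | Z D ≠ 0}

/-- The conic `a x² + b x y + c y² = e z²`, which is centered at `A`. The circle with center `A`
and radius `r` is the case `a = c = 1`, `b = 0`, `e = r²`. -/
noncomputable def centralConic {k : Type*} [Field k] (a b c e : k) : MvPolynomial (Fin 3) k :=
  C a * X 0 ^ 2 + C b * X 0 * X 1 + C c * X 1 ^ 2 - C e * X 2 ^ 2

/-! Over `k` the form a x² + b x y + c y² splits: in a suitable isotropic basis it reads e p q. A
point off the line at infinity and off the asymptotic lines then has polar coordinates (s, t): its
direction is m(t, 1/t), on which the form takes the value e, and its radius is s. The only ambiguity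
is that (s, t) and (-s, -t) give the same point. The conic B is s = ±1, and changing s by ±1
realizes the incidence relation, so a curve with generic point (s, t) contributes to the conchoid
the curves through (s + 1, t) and (s - 1, t) (`exists_through_conchoid_ne_zero`,
`IsPolarFrame.exists_mem_cycleComponents`).

Suppose that E is the only component of the proper conchoid, while C has components D₁ ≠ D₂. Polar
coordinates may be chosen with D₁ through (s - 1, t), D₂ through (s' - 1, t') and E through (s, t)
and (s', t'). A curve determines its generic polar coordinates up to sign
(`IsPolarFrame.polarSpecializes_or`). If the signs agree, then D₁ = D₂. Otherwise D₂ passes through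
(s + 1, t), so E lies midway between D₁ and D₂. Translating once more, E also passes through (s + 2,
t) and (s - 2, t). By the same uniqueness, the generic point of E specializes under a translation of
the radius by 2, -2 or 4. Iterating it carries D₁ onto D₂: by hitting the translation by 2 in
positive characteristic, and by a polynomial having infinitely many zeros in characteristic 0
(`IsPolarFrame.eq_of_polarSpecializes_add`).

The argument breaks when s ± 2 is 0, 1 or -1, as the translated curve then collapses to A or is B,
which is removed. In that case all the curves are conics of constant integral radius, and
`IsPolarFrame.false_of_add_two` compares the radii; only C = B + B₂ in characteristic 5 escapes. -/

/-! ### Irreducible polynomials with a common generic zero -/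

theorem MvPolynomial.aeval_smul_of_isHomogeneous {σ R A : Type*} [CommRing R] [CommRing A]
    [Algebra R A] {f : MvPolynomial σ R} {n : ℕ} (hf : f.IsHomogeneous n) (c : A) (v : σ → A) :
    aeval (c • v) f = c ^ n * aeval v f := by
  rw [aeval_def, aeval_def, eval₂_eq, eval₂_eq, Finset.mul_sum]
  refine Finset.sum_congr rfl fun d hd => ?_
  have hdeg := hf.degree_eq_sum_deg_support hd
  simp only [Pi.smul_apply, smul_eq_mul, mul_pow, Finset.prod_mul_distrib, Finset.prod_pow_eq_pow_sum]
  rw [hdeg]; ring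

theorem MvPolynomial.eval₂_finSuccEquiv {R A : Type*} [CommRing R] [CommRing A] [Algebra R A]
    {n : ℕ} (u : Fin (n + 1) → A) (f : MvPolynomial (Fin (n + 1)) R) :
    Polynomial.eval₂ (aeval (R := R) fun i : Fin n => u i.succ : MvPolynomial (Fin n) R →+* A) (u 0)
      (finSuccEquiv R n f) = aeval u f := by
  have key : (Polynomial.eval₂RingHom
      (aeval (R := R) fun i : Fin n => u i.succ : MvPolynomial (Fin n) R →+* A) (u 0)).comp
      (finSuccEquiv R n : MvPolynomial (Fin (n + 1)) R →+* _) =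
      (aeval u : MvPolynomial (Fin (n + 1)) R →ₐ[R] A) := by
    refine MvPolynomial.ringHom_ext (fun r => ?_) (fun i => ?_)
    · simp [finSuccEquiv_apply]
    · refine Fin.cases ?_ (fun i => ?_) i
      · simp [finSuccEquiv_X_zero]
      · simp [finSuccEquiv_X_succ]
  exact congrArg (fun g => g f) key

/-- Two irreducible polynomials over a unique factorization domain with a common zero in a field
extension are associated, unless the zero is a zero of a constant. -/
theorem Polynomial.associated_of_irreducible_of_eval₂_eq_zero {R A : Type*} [CommRing R] [IsDomain R]
    [IsGCDMonoid R] [Field A] (φ : R →+* A) (hφ : Function.Injective φ) (x : A)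
    {p q : Polynomial R} (hp : Irreducible p) (hq : Irreducible q)
    (hpx : p.eval₂ φ x = 0) (hqx : q.eval₂ φ x = 0) : Associated p q := by
  have aux : ∀ {r : Polynomial R}, Irreducible r → r.eval₂ φ x = 0 → r.IsPrimitive := by
    intro r hr hrx
    refine hr.isPrimitive fun hdeg => ?_
    rw [Polynomial.eq_C_of_natDegree_eq_zero hdeg, Polynomial.eval₂_C] at hrx
    have h0 := hφ (hrx.trans (map_zero φ).symm)
    apply hr.ne_zero
    rw [Polynomial.eq_C_of_natDegree_eq_zero hdeg, h0, Polynomial.C_0]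
  have hpp := aux hp hpx
  have hqp := aux hq hqx
  let K := FractionRing R
  let _ : Algebra R A := φ.toAlgebra
  have _ : FaithfulSMul R A := (faithfulSMul_iff_algebraMap_injective R A).2 hφ
  let _ : Algebra K A := FractionRing.liftAlgebra R A
  have _ : IsScalarTower R K A := FractionRing.isScalarTower_liftAlgebra R A
  have ev : ∀ r : Polynomial R, r.eval₂ φ x = 0 →
      Polynomial.aeval x (r.map (algebraMap R K)) = 0 := by
    intro r hr
    rw [Polynomial.aeval_map_algebraMap]
    exact hr
  have hpK := hpp.irreducible_iff_irreducible_map_fraction_map (K := K) |>.1 hp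
  have hqK := hqp.irreducible_iff_irreducible_map_fraction_map (K := K) |>.1 hq
  have hint : IsIntegral K x :=
    isAlgebraic_iff_isIntegral.1 ⟨_, hpK.ne_zero, ev p hpx⟩
  have hnu := (minpoly.irreducible hint).not_isUnit
  have h1 := hpK.dvd_iff.1 (minpoly.dvd K x (ev p hpx)) |>.resolve_left hnu
  have h2 := minpoly.dvd K x (ev q hqx)
  have h3 := hpp.dvd_of_fraction_map_dvd_fraction_map (h1.dvd.trans h2)
  exact hp.associated_of_dvd hq h3

/-- Irreducible polynomials in three variables that vanish at a point with two algebraically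
independent coordinates are associated. -/
theorem associated_of_irreducible_of_aeval_eq_zero {k A : Type*} [Field k] [Field A] [Algebra k A]
    (u : Fin 3 → A) {i j : Fin 3} (hu : AlgebraicIndependent k ![u i, u j])
    {p q : MvPolynomial (Fin 3) k} (hp : Irreducible p) (hq : Irreducible q)
    (hpu : aeval u p = 0) (hqu : aeval u q = 0) : Associated p q := by
  have hij : i ≠ j := by
    rintro rfl
    exact absurd (hu.injective (a₁ := 0) (a₂ := 1) rfl) (by decide)
  obtain ⟨l, hli, hlj⟩ : ∃ l : Fin 3, l ≠ i ∧ l ≠ j := by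
    clear hu; revert i j; decide
  obtain ⟨σ, hσ'⟩ : ∃ σ : Equiv.Perm (Fin 3), ⇑σ = ![l, i, j] := ⟨Equiv.ofBijective ![l, i, j] (by
    rw [Finite.injective_iff_bijective.symm]
    intro a b hab
    fin_cases a <;> fin_cases b <;> simp_all), rfl⟩
  have hσ : ∀ r : MvPolynomial (Fin 3) k, aeval (u ∘ σ) (renameEquiv k σ.symm r) = aeval u r := by
    intro r
    rw [renameEquiv_apply, aeval_rename]
    congr 2
    ext a; simp
  have hΦ : ∀ r, aeval u r = 0 → Polynomial.eval₂ (aeval (R := k) fun i : Fin 2 => (u ∘ σ) i.succ :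
      MvPolynomial (Fin 2) k →+* A) ((u ∘ σ) 0)
      (finSuccEquiv k 2 (renameEquiv k σ.symm r)) = 0 := by
    intro r hr
    rw [MvPolynomial.eval₂_finSuccEquiv (u ∘ σ), hσ, hr]
  have hind : (fun i : Fin 2 => (u ∘ σ) i.succ) = ![u i, u j] := by
    ext a; fin_cases a <;> simp [hσ']
  have hirr : ∀ r, Irreducible r → Irreducible (finSuccEquiv k 2 (renameEquiv k σ.symm r)) :=
    fun r hr => (MulEquiv.irreducible_iff (finSuccEquiv k 2)).2
      ((MulEquiv.irreducible_iff (renameEquiv k σ.symm)).2 hr)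
  -- The variable with index `l` becomes the main one, over the polynomial ring in the two variables
  -- whose values are independent; there Gauss's lemma applies.
  have hdvd := (Polynomial.associated_of_irreducible_of_eval₂_eq_zero
    (aeval (R := k) fun i : Fin 2 => (u ∘ σ) i.succ : MvPolynomial (Fin 2) k →+* A)
    (by rw [hind]; exact hu) ((u ∘ σ) 0) (hirr p hp) (hirr q hq) (hΦ p hpu) (hΦ q hqu)).dvd
  rw [map_dvd_iff (finSuccEquiv k 2), map_dvd_iff (renameEquiv k σ.symm)] at hdvd
  exact hp.associated_of_dvd hq hdvd

theorem Ideal.IsPrime.exists_irreducible_dvd_mem {R : Type*} [CommRing R] [IsDomain R]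
    [UniqueFactorizationMonoid R] {P : Ideal R} (hP : P.IsPrime) {f : R} (hf : f ∈ P)
    (hf0 : f ≠ 0) : ∃ g, Irreducible g ∧ g ∣ f ∧ g ∈ P := by
  obtain ⟨s, hs, hsf⟩ := UniqueFactorizationMonoid.exists_prime_factors f hf0
  have hmem : s.prod ∈ P := (Ideal.mem_iff_of_associated hsf).2 hf
  obtain ⟨g, hgs, hgP⟩ := (hP.multiset_prod_mem_iff_exists_mem s).1 hmem
  exact ⟨g, (hs g hgs).irreducible, (Multiset.dvd_prod hgs).trans hsf.dvd, hgP⟩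

/-! ### Generic points of cones -/

section Cone

variable {k Ω K : Type*} [Field k] [Field Ω] [Field K] [Algebra k Ω] [Algebra k K] [Algebra Ω K]
  [IsScalarTower k Ω K]

/-- Scaling by `U` multiplies the component of degree n by `U ^ n`, and powers of a transcendental
are independent over `Ω`. Evaluation at such a point thus cuts out the homogeneous ideal of `v`. -/
theorem aeval_transcendental_smul_eq_zero_iff {σ : Type*} {U : K} (hU : Transcendental Ω U)
    (v : σ → Ω) (f : MvPolynomial σ k) :
    aeval (fun i => U * algebraMap Ω K (v i)) f = 0 ↔
      ∀ n, aeval v (homogeneousComponent n f) = 0 := by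
  have key : ∀ n, aeval (fun i => U * algebraMap Ω K (v i)) (homogeneousComponent n f) =
      U ^ n * algebraMap Ω K (aeval v (homogeneousComponent n f)) := by
    intro n
    have := aeval_smul_of_isHomogeneous (homogeneousComponent_isHomogeneous n f) U
      (fun i => algebraMap Ω K (v i))
    rw [show (fun i => U * algebraMap Ω K (v i)) = U • (fun i => algebraMap Ω K (v i)) from rfl,
      this]
    congr 1
    exact aeval_algebraMap_apply K v _
  have hsum : aeval (fun i => U * algebraMap Ω K (v i)) f = Polynomial.aeval U
      (∑ n ∈ Finset.range (f.totalDegree + 1),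
        Polynomial.monomial n (aeval v (homogeneousComponent n f))) := by
    conv_lhs => rw [← sum_homogeneousComponent f]
    rw [map_sum, map_sum]
    refine Finset.sum_congr rfl fun n _ => ?_
    rw [key, Polynomial.aeval_monomial, mul_comm]
  rw [hsum]
  constructor
  · intro h n
    have h0 := (transcendental_iff.1 hU) _ h
    by_cases hn : n < f.totalDegree + 1
    · have := congrArg (fun q => Polynomial.coeff q n) h0
      simpa [Polynomial.finsetSum_coeff, Polynomial.coeff_monomial, hn] using this
    · rw [homogeneousComponent_eq_zero _ _ (by omega), map_zero]
  · intro h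
    simp [h]

theorem eq_zero_of_isHomogeneous_of_aeval_eq_zero [Infinite k] {f : MvPolynomial (Fin 2) k} {n : ℕ}
    (hf : f.IsHomogeneous n) {a b : Ω} (hb : b ≠ 0) (hab : Transcendental k (a / b))
    (h : aeval ![a, b] f = 0) : f = 0 := by
  have h1 : aeval ![a / b, 1] f = 0 := by
    have : ![a, b] = b • ![a / b, 1] := by
      ext i; fin_cases i <;> simp [mul_div_cancel₀ _ hb]
    rw [this, aeval_smul_of_isHomogeneous hf] at h
    exact (mul_eq_zero.1 h).resolve_left (pow_ne_zero _ hb)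
  have h2 : aeval ![(Polynomial.X : Polynomial k), 1] f = 0 := by
    apply (transcendental_iff.1 hab)
    rw [← AlgHom.comp_apply, comp_aeval]
    rw [← h1]
    congr 2
    ext i; fin_cases i <;> simp
  have h3 : ∀ c : k, eval ![c, 1] f = 0 := by
    intro c
    have := congrArg (Polynomial.aeval c) h2
    rw [← AlgHom.comp_apply, comp_aeval, map_zero] at this
    rw [← this, ← coe_aeval_eq_eval, RingHom.coe_coe]
    congr 2
    ext i; fin_cases i <;> simp
  -- Dehomogenizing controls `f` only where the second coordinate is nonzero; the factor `X 1`
  -- covers the rest.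
  have h4 : f * X 1 = 0 := by
    refine MvPolynomial.funext fun x => ?_
    by_cases hx : x 1 = 0
    · simp [hx]
    · have : x = x 1 • ![x 0 / x 1, 1] := by
        ext i; fin_cases i <;> simp [mul_div_cancel₀ _ hx]
      have h5 := aeval_smul_of_isHomogeneous hf (x 1) ![x 0 / x 1, 1]
      rw [← this, aeval_eq_eval, aeval_eq_eval, h3, mul_zero] at h5
      simp [h5]
  exact (mul_eq_zero.1 h4).resolve_right (X_ne_zero 1)

theorem algebraicIndependent_transcendental_mul [Infinite k] {U : K} (hU : Transcendental Ω U)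
    {a b : Ω} (hb : b ≠ 0) (hab : Transcendental k (a / b)) :
    AlgebraicIndependent k ![U * algebraMap Ω K a, U * algebraMap Ω K b] := by
  rw [algebraicIndependent_iff]
  intro f hf
  have hv : ![U * algebraMap Ω K a, U * algebraMap Ω K b] =
      fun i => U * algebraMap Ω K (![a, b] i) := by
    ext i; fin_cases i <;> rfl
  rw [hv, aeval_transcendental_smul_eq_zero_iff hU] at hf
  rw [← sum_homogeneousComponent f]
  exact Finset.sum_eq_zero fun n _ => eq_zero_of_isHomogeneous_of_aeval_eq_zero
    (homogeneousComponent_isHomogeneous n f) hb hab (hf n)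

end Cone

theorem exists_transcendental_extension.{u, v} (k : Type u) {Ω : Type v} [Field k] [Field Ω] [Algebra k Ω] :
    ∃ (K : Type v) (_ : Field K) (_ : Algebra k K) (_ : Algebra Ω K) (_ : IsScalarTower k Ω K)
      (U : K), Transcendental Ω U :=
  let _ : Algebra k (RatFunc Ω) := ((algebraMap Ω (RatFunc Ω)).comp (algebraMap k Ω)).toAlgebra
  ⟨RatFunc Ω, RatFunc.instField Ω, ‹_›, RatFunc.instAlgebraOfPolynomial Ω Ω,
    IsScalarTower.of_algebraMap_eq fun _ => rfl, RatFunc.X, RatFunc.transcendental_X⟩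

/-! ### Plane curves through a generic point -/

/-- The coordinates of a point of the projective plane over an extension of `k` have a ratio that is
transcendental over `k`. -/
def HasTranscendentalRatio (k : Type*) {Ω : Type*} [Field k] [Field Ω] [Algebra k Ω] (w : Fin 3 → Ω) : Prop :=
  ∃ i j, w j ≠ 0 ∧ Transcendental k (w i / w j)

/-- The curve `D` passes through the point `w`. -/
def PrimeCurve.Through {k Ω : Type*} [Field k] [Field Ω] [Algebra k Ω] (D : PrimeCurve k)
    (w : Fin 3 → Ω) : Prop :=
  ∀ f ∈ D.ideal, aeval w f = 0

section Curves

variable {k Ω : Type*} [Field k] [Field Ω] [Algebra k Ω]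

theorem aeval_eq_zero_of_forall_homogeneousComponent {σ : Type*} {w : σ → Ω}
    {f : MvPolynomial σ k} (h : ∀ n, aeval w (homogeneousComponent n f) = 0) : aeval w f = 0 := by
  rw [← sum_homogeneousComponent f, map_sum]
  exact Finset.sum_eq_zero fun n _ => h n

theorem MvPolynomial.IsHomogeneous.aeval_homogeneousComponent {σ : Type*} {w : σ → Ω}
    {f : MvPolynomial σ k} {d : ℕ} (hf : f.IsHomogeneous d) (h : MvPolynomial.aeval w f = 0) (n : ℕ) :
    MvPolynomial.aeval w (homogeneousComponent n f) = 0 := by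
  rw [homogeneousComponent_of_mem hf]
  split_ifs <;> simp [h]

/-- The polynomials whose homogeneous components vanish at a point form a prime ideal. -/
theorem exists_isPrime_forall_homogeneousComponent (k : Type*) [Field k] [Algebra k Ω] [Infinite k]
    {w : Fin 3 → Ω} (hw : HasTranscendentalRatio k w) :
    ∃ P : Ideal (MvPolynomial (Fin 3) k), P.IsPrime ∧
      (∀ f, f ∈ P ↔ ∀ n, aeval w (homogeneousComponent n f) = 0) ∧
      ∀ p q, Irreducible p → Irreducible q → p ∈ P → q ∈ P → Associated p q := by
  obtain ⟨K, _, _, _, _, U, hU⟩ := exists_transcendental_extension k (Ω := Ω)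
  obtain ⟨i, j, hj, hij⟩ := hw
  let u : Fin 3 → K := fun i => U * algebraMap Ω K (w i)
  refine ⟨RingHom.ker (aeval u : MvPolynomial (Fin 3) k →ₐ[k] K),
    RingHom.ker_isPrime _, fun f => ?_, fun p q hp hq hpP hqP => ?_⟩
  · exact RingHom.mem_ker.trans (aeval_transcendental_smul_eq_zero_iff hU w f)
  · exact associated_of_irreducible_of_aeval_eq_zero u (i := i) (j := j)
      (algebraicIndependent_transcendental_mul hU hj hij) hp hq hpP hqP

variable [Infinite k] {w : Fin 3 → Ω}

/-- A point with a transcendental ratio is generic on any curve through it: the homogeneous ideal of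
the point is prime, and each irreducible element of it is associated to the equation of the curve.
-/
theorem PrimeCurve.Through.mem_iff {D : PrimeCurve k} (hD : D.Through w) (hw : HasTranscendentalRatio k w)
    {f : MvPolynomial (Fin 3) k} :
    f ∈ D.ideal ↔ ∀ n, aeval w (homogeneousComponent n f) = 0 := by
  obtain ⟨P, hP, hPmem, hPass⟩ := exists_isPrime_forall_homogeneousComponent k hw
  obtain ⟨d, H, hHd, hH, hDH⟩ := D.exists_form
  have hHD : H ∈ D.ideal := hDH ▸ Ideal.mem_span_singleton_self H
  have hHP : H ∈ P := (hPmem H).2 (hHd.aeval_homogeneousComponent (hD H hHD))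
  rw [← hPmem]
  constructor
  · intro hf
    rw [hDH, Ideal.mem_span_singleton] at hf
    exact P.mem_of_dvd hf hHP
  · intro hf
    by_cases hf0 : f = 0
    · rw [hf0]; exact D.ideal.zero_mem
    obtain ⟨g, hg, hgf, hgP⟩ := hP.exists_irreducible_dvd_mem hf hf0
    rw [hDH, Ideal.mem_span_singleton]
    exact (hPass H g hH hg hHP hgP).dvd.trans hgf

theorem PrimeCurve.Through.mem {D : PrimeCurve k} (hD : D.Through w) (hw : HasTranscendentalRatio k w)
    {f : MvPolynomial (Fin 3) k} {d : ℕ} (hf : f.IsHomogeneous d) (h : aeval w f = 0) :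
    f ∈ D.ideal :=
  (hD.mem_iff hw).2 (hf.aeval_homogeneousComponent h)

theorem PrimeCurve.Through.eq {D D' : PrimeCurve k} (hD : D.Through w) (hD' : D'.Through w)
    (hw : HasTranscendentalRatio k w) : D = D' :=
  PrimeCurve.ext (Ideal.ext fun _ => (hD.mem_iff hw).trans (hD'.mem_iff hw).symm)

/-- A nonzero prime ideal of polynomials whose homogeneous components vanish at a generic point is
the ideal of a curve. -/
theorem exists_primeCurve_ideal_eq (hw : HasTranscendentalRatio k w) {P : Ideal (MvPolynomial (Fin 3) k)}
    (hP : P.IsPrime) (hP0 : P ≠ ⊥)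
    (hPw : ∀ f ∈ P, ∀ n, aeval w (homogeneousComponent n f) = 0) :
    ∃ D : PrimeCurve k, D.ideal = P ∧ D.Through w := by
  obtain ⟨P', hP', hPmem, hPass⟩ := exists_isPrime_forall_homogeneousComponent k hw
  have hle : P ≤ P' := fun f hf => (hPmem f).2 (hPw f hf)
  obtain ⟨f, hf, hf0⟩ := Submodule.exists_mem_ne_zero_of_ne_bot hP0
  obtain ⟨H, hH, -, hHP⟩ := hP.exists_irreducible_dvd_mem hf hf0
  have hdvd : ∀ g ∈ P', H ∣ g := by
    intro g hg
    by_cases hg0 : g = 0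
    · simp [hg0]
    obtain ⟨q, hq, hqg, hqP⟩ := hP'.exists_irreducible_dvd_mem hg hg0
    exact (hPass H q hH hq (hle hHP) hqP).dvd.trans hqg
  have hcomp : ∀ n, homogeneousComponent n H ∈ P' := fun n =>
    (hPmem _).2 ((homogeneousComponent_isHomogeneous n H).aeval_homogeneousComponent
      ((hPmem H).1 (hle hHP) n))
  -- `H` divides each of its own homogeneous components, so by degree only the top one is nonzero.
  have hex : ∀ n, homogeneousComponent n H ≠ 0 → n = H.totalDegree := by
    intro n hn
    apply le_antisymm
    · by_contra! h
      exact hn (homogeneousComponent_eq_zero _ _ h)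
    · obtain ⟨q, hq⟩ := hdvd _ (hcomp n)
      have hq0 : q ≠ 0 := by rintro rfl; simp [hq] at hn
      have h1 := (homogeneousComponent_isHomogeneous n H).totalDegree hn
      rw [hq, totalDegree_mul_of_isDomain hH.ne_zero hq0] at h1
      omega
  have hhom : H.IsHomogeneous H.totalDegree := by
    have : H = homogeneousComponent H.totalDegree H := by
      conv_lhs => rw [← sum_homogeneousComponent H]
      refine Finset.sum_eq_single _ (fun n _ hn => ?_) (fun h => ?_)
      · by_contra h
        exact hn (hex n h)
      · simp at h
    rw [this]
    have h2 := homogeneousComponent_isHomogeneous H.totalDegree H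
    rwa [← this] at h2 ⊢
  refine ⟨⟨P, _, H, hhom, hH, le_antisymm (fun g hg => ?_) ?_⟩, rfl, fun g hg => ?_⟩
  · exact Ideal.mem_span_singleton.2 (hdvd g (hle hg))
  · rwa [Ideal.span_singleton_le_iff_mem]
  · exact aeval_eq_zero_of_forall_homogeneousComponent (hPw g hg)

end Curves

/-! ### The incidence relation and the coefficients of the conchoid -/

/-- The value of the quadratic form `a x² + b x y + c y²`. -/
def binaryForm {k A : Type*} [CommRing k] [CommRing A] [Algebra k A] (a b c : k) (x y : A) : A :=
  algebraMap k A a * x ^ 2 + algebraMap k A b * x * y + algebraMap k A c * y ^ 2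

/-- The points `v` and `w` correspond to each other under the incidence relation that defines the
conchoids with respect to the conic `a x² + b x y + c y² = e z²`. -/
def ConchoidIncident {k A : Type*} [CommRing k] [CommRing A] [Algebra k A] (a b c e : k)
    (v w : Fin 3 → A) : Prop :=
  binaryForm a b c (v 2 * w 0 - v 0 * w 2) (v 2 * w 1 - v 1 * w 2) =
      algebraMap k A e * (v 2 * w 2) ^ 2 ∧
    v 0 * w 1 = v 1 * w 0

theorem binaryForm_mul {k A : Type*} [CommRing k] [CommRing A] [Algebra k A] (a b c : k)
    (r x y : A) : binaryForm a b c (r * x) (r * y) = r ^ 2 * binaryForm a b c x y := by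
  simp only [binaryForm]; ring

theorem aeval_centralConic {k A : Type*} [Field k] [CommRing A] [Algebra k A] (a b c e : k)
    (u : Fin 3 → A) : aeval u (centralConic a b c e) =
      binaryForm a b c (u 0) (u 1) - algebraMap k A e * u 2 ^ 2 := by
  simp [centralConic, binaryForm]

theorem isHomogeneous_centralConic {k : Type*} [Field k] (a b c e : k) :
    (centralConic a b c e).IsHomogeneous 2 := by
  unfold centralConic
  refine ((IsHomogeneous.add ?_ ?_).add ?_).sub ?_
  · exact isHomogeneous_C_mul_X_pow a 0 2
  · exact (isHomogeneous_C_mul_X b 0).mul (isHomogeneous_X k 1)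
  · exact isHomogeneous_C_mul_X_pow c 1 2
  · exact isHomogeneous_C_mul_X_pow e 2 2

theorem centralConic_ne_zero {k : Type*} [Field k] {a b c e : k} (he : e ≠ 0) :
    centralConic a b c e ≠ 0 := by
  intro h
  have := congrArg (aeval (R := k) ![(0 : k), 0, 1]) h
  rw [aeval_centralConic] at this
  simp [binaryForm, he] at this

theorem pullbackIdeal_le_ker_iff {k A : Type*} [Field k] [CommRing A] [Algebra k A] (a b c e : k)
    (G : MvPolynomial (Fin 3) k) (ξ : Fin 3 ⊕ Fin 3 → A) :
    pullbackIdeal (centralConic a b c e) G ≤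
        RingHom.ker (aeval ξ : MvPolynomial (Fin 3 ⊕ Fin 3) k →ₐ[k] A) ↔
      ConchoidIncident a b c e (ξ ∘ Sum.inl) (ξ ∘ Sum.inr) ∧ aeval (ξ ∘ Sum.inl) G = 0 := by
  rw [pullbackIdeal, incidenceIdeal, sup_le_iff, Ideal.span_le, Ideal.span_le,
    Set.singleton_subset_iff, Set.insert_subset_iff, Set.singleton_subset_iff]
  simp only [SetLike.mem_coe, RingHom.mem_ker, aeval_rename, aeval_centralConic]
  refine and_congr (and_congr ?_ ?_) Iff.rfl
  · simp [binaryForm, sub_eq_zero]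
  · simp [sub_eq_zero]

theorem binaryForm_ne_zero_of_algebraicIndependent {k A : Type*} [Field k] [Field A] [Algebra k A]
    {a b c : k} (hdisc : b ^ 2 - 4 * a * c ≠ 0) {w : Fin 3 → A} (hw : AlgebraicIndependent k w) :
    binaryForm a b c (w 0) (w 1) ≠ 0 := by
  intro h
  have h0 : (C a * X 0 ^ 2 + C b * X 0 * X 1 + C c * X 1 ^ 2 : MvPolynomial (Fin 3) k) = 0 :=
    (algebraicIndependent_iff.1 hw) _ (by simpa [binaryForm] using h)
  have ev : ∀ x y : k, a * x ^ 2 + b * x * y + c * y ^ 2 = 0 := fun x y => by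
    simpa using congrArg (eval ![x, y, 0]) h0
  have ha := ev 1 0
  have hc := ev 0 1
  have hb := ev 1 1
  simp at ha hc
  subst ha hc
  simp at hb
  simp [hb] at hdisc

/-- Corresponding points `v` and `w`, where `v` lies on a curve, cannot have `w` generic in the
space of homogeneous coordinates. -/
theorem not_algebraicIndependent_of_conchoidIncident {k A : Type*} [Field k] [Field A] [Algebra k A]
    {a b c e : k} (hdisc : b ^ 2 - 4 * a * c ≠ 0) (he : e ≠ 0) {G : MvPolynomial (Fin 3) k} {δ : ℕ}
    (hG : G.IsHomogeneous δ) (hG0 : G ≠ 0) {v w : Fin 3 → A} (hv : v ≠ 0)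
    (hvw : ConchoidIncident a b c e v w) (hGv : aeval v G = 0) : ¬ AlgebraicIndependent k w := by
  intro hw
  have hq := binaryForm_ne_zero_of_algebraicIndependent hdisc hw
  have he' : algebraMap k A e ≠ 0 := by simpa using he
  have hw0 : w 0 ≠ 0 := hw.ne_zero 0
  have hw2 : w 2 ≠ 0 := hw.ne_zero 2
  obtain ⟨h1, h2⟩ := hvw
  obtain ⟨l, hl⟩ : ∃ l, v 0 = l * w 0 := ⟨v 0 / w 0, by field_simp⟩
  have hl1 : v 1 = l * w 1 := by
    apply mul_right_cancel₀ hw0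
    rw [← h2, hl]; ring
  have h3 : (v 2 - l * w 2) ^ 2 * binaryForm a b c (w 0) (w 1) =
      algebraMap k A e * (v 2 * w 2) ^ 2 := by
    rw [← h1, ← binaryForm_mul, hl, hl1]; congr 1 <;> ring
  have hz : v 2 ≠ 0 := by
    intro hz
    have : l = 0 := by simpa [hz, hq, hw2] using h3
    apply hv
    ext i; fin_cases i <;> simp [hl, hl1, hz, this]
  -- If `l = 0`, then `v` is the center A, and the relation forces `w` to lie on B.
  have hl0 : l ≠ 0 := by
    rintro rfl
    have h4 : binaryForm a b c (w 0) (w 1) = algebraMap k A e * w 2 ^ 2 := by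
      apply mul_left_cancel₀ (pow_ne_zero 2 hz)
      linear_combination h3
    refine centralConic_ne_zero he ((algebraicIndependent_iff.1 hw) (centralConic a b c e) ?_)
    rw [aeval_centralConic, h4, sub_self]
  obtain ⟨n, hn⟩ : ∃ n, v 2 = l * n := ⟨v 2 / l, by field_simp⟩
  have hn0 : n ≠ 0 := by rintro rfl; simp [hn] at hz
  have hGn : aeval ![w 0, w 1, n] G = 0 := by
    have : v = l • ![w 0, w 1, n] := by ext i; fin_cases i <;> simp [hl, hl1, hn]
    rw [this, aeval_smul_of_isHomogeneous hG] at hGv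
    exact (mul_eq_zero.1 hGv).resolve_left (pow_ne_zero _ hl0)
  -- `n` is algebraic over `S` because `G` vanishes at (w 0, w 1, n); the incidence relation then
  -- makes `w 2` algebraic over `S`, against independence.
  set S := Algebra.adjoin k (w '' {0, 1})
  have hZ : Transcendental S (w 2) := hw.transcendental_adjoin (by decide)
  let x0 : S := ⟨w 0, Algebra.subset_adjoin ⟨0, by simp⟩⟩
  let x1 : S := ⟨w 1, Algebra.subset_adjoin ⟨1, by simp⟩⟩
  let p : Polynomial S := aeval ![Polynomial.C x0, Polynomial.C x1, Polynomial.X] G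
  have hp : ∀ t : A, Polynomial.aeval t p = aeval ![w 0, w 1, t] G := by
    intro t
    change ((Polynomial.aeval t : Polynomial S →ₐ[S] A).restrictScalars k) p = _
    rw [← AlgHom.comp_apply, comp_aeval]
    congr 2
    ext i; fin_cases i <;> simp [x0, x1]
  have hnalg : IsAlgebraic S n := by
    refine ⟨p, fun h0 => ?_, by rw [hp, hGn]⟩
    have h5 := hp (w 2)
    rw [h0, map_zero] at h5
    apply hG0
    refine (algebraicIndependent_iff.1 hw) G ?_
    rw [h5]
    congr 2
    ext i; fin_cases i <;> rfl
  have hqalg : IsAlgebraic S (binaryForm a b c (w 0) (w 1)) :=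
    isAlgebraic_algebraMap (binaryForm a b c x0 x1)
  have healg : IsAlgebraic S (algebraMap k A e) := by
    rw [IsScalarTower.algebraMap_apply k S A]; exact isAlgebraic_algebraMap _
  have h6 : (n / w 2 - 1) ^ 2 =
      algebraMap k A e * n ^ 2 * (binaryForm a b c (w 0) (w 1))⁻¹ := by
    rw [hn] at h3
    have : (n - w 2) ^ 2 * binaryForm a b c (w 0) (w 1) = algebraMap k A e * (n * w 2) ^ 2 := by
      apply mul_left_cancel₀ (pow_ne_zero 2 hl0)
      linear_combination h3
    field_simp
    linear_combination this
  have h7 : IsAlgebraic S ((n / w 2 - 1) ^ 2) := by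
    rw [h6]
    exact (healg.mul (hnalg.pow 2)).mul hqalg.inv
  have h8 : IsAlgebraic S (n / w 2) := by
    have := (h7.of_pow (by norm_num)).add (isAlgebraic_one (R := S))
    simpa using this
  have h9 : IsAlgebraic S (n * (n / w 2)⁻¹) := hnalg.mul h8.inv
  apply hZ
  convert h9 using 1
  field_simp

/-- For given `w`, the ratio of the first two coordinates of `v` is that of `w`, and the remaining
ratio satisfies an equation of degree at most two, which `hw'` keeps from being identically zero.
This makes π₂ generically finite on the components in question. -/
theorem isAlgebraic_div_of_conchoidIncident {k A : Type*} [Field k] [Field A] [Algebra k A]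
    {a b c e : k} (he : e ≠ 0) {v w : Fin 3 → A}
    (hvw : ConchoidIncident a b c e v w) (hw : w 0 ≠ 0 ∨ w 1 ≠ 0)
    (hw' : binaryForm a b c (w 0) (w 1) ≠ 0 ∨ w 2 ≠ 0) {N : IntermediateField k A}
    (hN : ∀ i j, w i / w j ∈ N) (m n : Fin 3) : IsAlgebraic N (v m / v n) := by
  obtain ⟨i, hi2, hi⟩ : ∃ i : Fin 3, i ≠ 2 ∧ w i ≠ 0 := by
    rcases hw with h | h
    exacts [⟨0, by decide, h⟩, ⟨1, by decide, h⟩]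
  obtain ⟨h1, h2⟩ := hvw
  obtain ⟨α, hα⟩ : ∃ α : Fin 3 → A, ∀ l, α l = w l / w i := ⟨_, fun _ => rfl⟩
  have hαN : ∀ l, IsAlgebraic N (α l) := fun l =>
    hα l ▸ isAlgebraic_algebraMap (⟨_, hN l i⟩ : N)
  have hwα : ∀ l, w l = w i * α l := fun l => by rw [hα]; field_simp
  have hvα : ∀ l, l ≠ 2 → v l = v i * α l := by
    intro l hl
    rw [hα, ← mul_div_assoc, eq_div_iff hi]
    fin_cases l <;> fin_cases i <;> first
      | rfl
      | exact absurd rfl hl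
      | exact absurd rfl hi2
      | exact h2
      | exact h2.symm
  by_cases hvi : v i = 0
  -- Only `v 2` can be nonzero, so each ratio is 0 or 1, division by zero giving 0.
  · have hv0 : ∀ l, l ≠ 2 → v l = 0 := fun l hl => by rw [hvα l hl, hvi, zero_mul]
    by_cases hm : m = 2
    · by_cases hn : n = 2
      · subst hm hn
        by_cases h : v 2 = 0
        · simpa [h] using isAlgebraic_zero
        · simpa [h] using isAlgebraic_one
      · simpa [hv0 n hn] using isAlgebraic_zero
    · simpa [hv0 m hm] using isAlgebraic_zero
  · have he' : algebraMap k A e ≠ 0 := by simpa using he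
    have hkalg : ∀ r : k, IsAlgebraic N (algebraMap k A r) := fun r => by
      rw [IsScalarTower.algebraMap_apply k N A]; exact isAlgebraic_algebraMap _
    have hqalg : IsAlgebraic N (binaryForm a b c (α 0) (α 1)) :=
      (((hkalg a).mul ((hαN 0).pow 2)).add (((hkalg b).mul (hαN 0)).mul (hαN 1))).add
        ((hkalg c).mul ((hαN 1).pow 2))
    obtain ⟨ζ, hζ⟩ : ∃ ζ, v 2 = v i * ζ := ⟨v 2 / v i, by field_simp⟩
    have h3 : (ζ - α 2) ^ 2 * binaryForm a b c (α 0) (α 1) =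
        algebraMap k A e * (ζ * α 2) ^ 2 := by
      apply mul_left_cancel₀ (pow_ne_zero 2 (mul_ne_zero hvi hi))
      rw [hwα 0, hwα 1, hwα 2, hvα 0 (by decide), hvα 1 (by decide), hζ] at h1
      have h4 : binaryForm a b c (v i * ζ * (w i * α 0) - v i * α 0 * (w i * α 2))
          (v i * ζ * (w i * α 1) - v i * α 1 * (w i * α 2)) =
          (v i * w i * (ζ - α 2)) ^ 2 * binaryForm a b c (α 0) (α 1) := by
        rw [← binaryForm_mul]; congr 1 <;> ring
      rw [h4] at h1
      linear_combination h1
    have hq' : binaryForm a b c (α 0) (α 1) ≠ 0 ∨ α 2 ≠ 0 := by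
      rw [hwα 0, hwα 1, binaryForm_mul, hwα 2] at hw'
      exact hw'.imp right_ne_zero_of_mul right_ne_zero_of_mul
    have hζalg : IsAlgebraic N ζ := by
      by_cases h0 : ζ = 0
      · rw [h0]; exact isAlgebraic_zero
      have hq : binaryForm a b c (α 0) (α 1) ≠ 0 := by
        intro hq
        have h2 := hq'.resolve_left (not_not.2 hq)
        simp [hq, he', h0, h2] at h3
      have h5 : (1 - α 2 * ζ⁻¹) ^ 2 =
          algebraMap k A e * α 2 ^ 2 * (binaryForm a b c (α 0) (α 1))⁻¹ := by
        field_simp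
        linear_combination h3
      have h6 : IsAlgebraic N (1 - α 2 * ζ⁻¹) := by
        refine IsAlgebraic.of_pow (n := 2) (by norm_num) ?_
        rw [h5]
        exact ((hkalg e).mul ((hαN 2).pow 2)).mul hqalg.inv
      have h2 : α 2 ≠ 0 := by
        intro h2
        simp [h2, hq, h0] at h3
      have h7 : IsAlgebraic N (α 2 * (1 - (1 - α 2 * ζ⁻¹))⁻¹) :=
        (hαN 2).mul ((isAlgebraic_one).sub h6).inv
      convert h7 using 1
      rw [sub_sub_cancel]
      field_simp
    have hall : ∀ l, ∃ β, v l = v i * β ∧ IsAlgebraic N β := by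
      intro l
      by_cases hl : l = 2
      · subst hl; exact ⟨ζ, hζ, hζalg⟩
      · exact ⟨α l, hvα l hl, hαN l⟩
    obtain ⟨βm, hm, hma⟩ := hall m
    obtain ⟨βn, hn, hna⟩ := hall n
    rw [hm, hn, mul_div_mul_left _ _ hvi, div_eq_mul_inv]
    exact hma.mul hna.inv

/-- The function field is generated by finitely many ratios, so algebraicity makes the extension
finite; this excludes the value 0 that stands for an infinite degree. -/
theorem pushDegree_ne_zero {k : Type*} [Field k] (𝔓 : Ideal (MvPolynomial (Fin 3 ⊕ Fin 3) k))
    [𝔓.IsPrime]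
    (h : ∀ i j, IsAlgebraic (imageFunctionField 𝔓)
      (algebraMap (MvPolynomial (Fin 3 ⊕ Fin 3) k) 𝔓.ResidueField (X (Sum.inl i)) /
        algebraMap (MvPolynomial (Fin 3 ⊕ Fin 3) k) 𝔓.ResidueField (X (Sum.inl j)))) :
    pushDegree 𝔓 ≠ 0 := by
  have hle : imageFunctionField 𝔓 ≤ functionField 𝔓 :=
    IntermediateField.adjoin.mono _ _ _ Set.subset_union_right
  rw [pushDegree, IntermediateField.relfinrank_eq_finrank_of_le hle]
  have hfin : FiniteDimensional (imageFunctionField 𝔓) (IntermediateField.extendScalars hle) := by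
    let ξ : Fin 3 ⊕ Fin 3 → 𝔓.ResidueField := fun s =>
      algebraMap (MvPolynomial (Fin 3 ⊕ Fin 3) k) 𝔓.ResidueField (X s)
    let S : Set 𝔓.ResidueField := {f | ∃ i j, f = ξ (Sum.inl i) / ξ (Sum.inl j)} ∪
      {f | ∃ i j, f = ξ (Sum.inr i) / ξ (Sum.inr j)}
    have hS : S.Finite := by
      refine Set.Finite.union ?_ ?_
      · refine (Set.finite_range fun q : Fin 3 × Fin 3 =>
          ξ (Sum.inl q.1) / ξ (Sum.inl q.2)).subset ?_
        rintro _ ⟨i, j, rfl⟩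
        exact ⟨(i, j), rfl⟩
      · refine (Set.finite_range fun q : Fin 3 × Fin 3 =>
          ξ (Sum.inr q.1) / ξ (Sum.inr q.2)).subset ?_
        rintro _ ⟨i, j, rfl⟩
        exact ⟨(i, j), rfl⟩
    have heq : IntermediateField.extendScalars hle =
        IntermediateField.adjoin (imageFunctionField 𝔓) S :=
      IntermediateField.extendScalars_adjoin hle
    rw [heq]
    have := hS.to_subtype
    refine IntermediateField.finiteDimensional_adjoin ?_
    rintro x (⟨i, j, rfl⟩ | hx)
    · exact (h i j).isIntegral
    · have hx' : x ∈ imageFunctionField 𝔓 := IntermediateField.subset_adjoin _ _ hx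
      exact isIntegral_algebraMap (x := (⟨x, hx'⟩ : imageFunctionField 𝔓))
  exact Module.finrank_pos.ne'

theorem pullbackMultiplicity_ne_zero {k : Type*} [Field k] {F G : MvPolynomial (Fin 3) k}
    {𝔓 : Ideal (MvPolynomial (Fin 3 ⊕ Fin 3) k)} [𝔓.IsPrime] (h : pullbackIdeal F G ≤ 𝔓) :
    pullbackMultiplicity F G 𝔓 ≠ 0 := by
  have hne : (pullbackIdeal F G).map (algebraMap _ (Localization.AtPrime 𝔓)) ≠ ⊤ := by
    intro htop
    have h1 := Ideal.map_mono (f := algebraMap _ (Localization.AtPrime 𝔓)) h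
    rw [htop, top_le_iff, Localization.AtPrime.map_eq_maximalIdeal] at h1
    exact (IsLocalRing.maximalIdeal.isMaximal _).ne_top h1
  have := Ideal.Quotient.nontrivial_iff.2 hne
  exact Module.length_pos.ne'

theorem conchoid_ne_zero {k : Type*} [Field k] {F G : MvPolynomial (Fin 3) k} {D : PrimeCurve k}
    {𝔓 : Ideal (MvPolynomial (Fin 3 ⊕ Fin 3) k)} [𝔓.IsPrime] (h𝔓 : 𝔓 ∈ pullbackComponents F G)
    (hD : 𝔓.comap (rename Sum.inr : MvPolynomial (Fin 3) k →ₐ[k]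
      MvPolynomial (Fin 3 ⊕ Fin 3) k) = D.ideal)
    (hdeg : pushDegree 𝔓 ≠ 0) : conchoid F G D ≠ 0 := by
  have hfin : Finite (pullbackComponents F G) :=
    ((Ideal.finite_minimalPrimes_of_isNoetherianRing _ (pullbackIdeal F G)).subset
      fun _ h => h.1).to_subtype
  have := Fintype.ofFinite (pullbackComponents F G)
  rw [conchoid, finsum_eq_sum_of_fintype, Ne, Finset.sum_eq_zero_iff]
  intro h
  have h1 := h ⟨𝔓, h𝔓⟩ (Finset.mem_univ _)
  rw [conchoidContribution, if_pos hD] at h1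
  rcases mul_eq_zero.1 h1 with h2 | h2
  · exact pullbackMultiplicity_ne_zero h𝔓.1.1.2 h2
  · exact hdeg (by exact_mod_cast h2)

/-- If a point `v` on the curve `G = 0` and a generic point `w` of a curve correspond to each other,
then that curve is a component of the conchoid of `G = 0`. -/
theorem exists_through_conchoid_ne_zero {k Ω : Type*} [Field k] [Infinite k] [Field Ω] [Algebra k Ω]
    {a b c e : k} (hdisc : b ^ 2 - 4 * a * c ≠ 0) (he : e ≠ 0) {G : MvPolynomial (Fin 3) k} {δ : ℕ}
    (hG : G.IsHomogeneous δ) (hG0 : G ≠ 0) {v w : Fin 3 → Ω} (hv : v ≠ 0)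
    (hw : HasTranscendentalRatio k w) (hvw : ConchoidIncident a b c e v w) (hGv : aeval v G = 0)
    (hw01 : w 0 ≠ 0 ∨ w 1 ≠ 0) (hw' : binaryForm a b c (w 0) (w 1) ≠ 0 ∨ w 2 ≠ 0) :
    ∃ D : PrimeCurve k, D.Through w ∧ conchoid (centralConic a b c e) G D ≠ 0 := by
  obtain ⟨K, _, _, _, _, U, hU⟩ := exists_transcendental_extension k (Ω := Ω)
  -- Only `w` is scaled by `U`: the kernel then contracts, in the second set of variables, to the
  -- homogeneous ideal of `w`.
  let ξ : Fin 3 ⊕ Fin 3 → K :=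
    Sum.elim (fun i => algebraMap Ω K (v i)) (fun i => U * algebraMap Ω K (w i))
  let ψ : MvPolynomial (Fin 3 ⊕ Fin 3) k →ₐ[k] K := aeval ξ
  have hU0 : U ≠ 0 := by
    rintro rfl
    exact hU isAlgebraic_zero
  have hle : pullbackIdeal (centralConic a b c e) G ≤ RingHom.ker ψ := by
    refine (pullbackIdeal_le_ker_iff a b c e G ξ).2 ⟨⟨?_, ?_⟩, ?_⟩
    · have := congrArg (fun y => U ^ 2 * algebraMap Ω K y) hvw.1
      simp only [binaryForm, map_add, map_mul, map_pow, map_sub,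
        ← IsScalarTower.algebraMap_apply k Ω K] at this
      simp only [binaryForm, ξ, Function.comp_apply, Sum.elim_inl, Sum.elim_inr]
      linear_combination this
    · have := congrArg (fun y => U * algebraMap Ω K y) hvw.2
      simp only [map_mul] at this
      simp only [ξ, Function.comp_apply, Sum.elim_inl, Sum.elim_inr]
      linear_combination this
    · have : aeval (fun i => algebraMap Ω K (v i)) G = algebraMap Ω K (aeval v G) :=
        aeval_algebraMap_apply K v G
      rw [hGv, map_zero] at this
      exact this
  have := RingHom.ker_isPrime ψ
  -- `𝔮` may be smaller than the kernel, so the incidence relation is used again for the coordinates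
  -- `η` in its residue field. Whatever is nonzero under `ψ` stays nonzero there.
  obtain ⟨𝔮, h𝔮, h𝔮le⟩ := Ideal.exists_minimalPrimes_le hle
  have := h𝔮.1.1
  have hnotmem : ∀ f, ψ f ≠ 0 → algebraMap _ 𝔮.ResidueField f ≠ 0 := by
    intro f hf h0
    exact hf (h𝔮le (Ideal.algebraMap_residueField_eq_zero.1 h0))
  let η : Fin 3 ⊕ Fin 3 → 𝔮.ResidueField := fun s =>
    algebraMap (MvPolynomial (Fin 3 ⊕ Fin 3) k) 𝔮.ResidueField (X s)
  have hη : ∀ f, algebraMap (MvPolynomial (Fin 3 ⊕ Fin 3) k) 𝔮.ResidueField f = aeval η f := by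
    intro f
    have : IsScalarTower.toAlgHom k (MvPolynomial (Fin 3 ⊕ Fin 3) k) 𝔮.ResidueField = aeval η :=
      MvPolynomial.algHom_ext fun i => by simp [η]
    exact congrArg (fun g => g f) this
  have hle' : pullbackIdeal (centralConic a b c e) G ≤
      RingHom.ker (aeval η : MvPolynomial (Fin 3 ⊕ Fin 3) k →ₐ[k] 𝔮.ResidueField) := by
    intro f hf
    rw [RingHom.mem_ker, ← hη]
    exact Ideal.algebraMap_residueField_eq_zero.2 (h𝔮.1.2 hf)
  obtain ⟨hinc, hGη⟩ := (pullbackIdeal_le_ker_iff a b c e G η).1 hle'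
  have hηne : ∀ f, ψ f ≠ 0 → aeval η f ≠ 0 := fun f hf => hη f ▸ hnotmem f hf
  have hηX : ∀ s, ξ s ≠ 0 → η s ≠ 0 := fun s hs => hnotmem (X s) (by simpa [ψ] using hs)
  obtain ⟨i, hi⟩ : ∃ i, v i ≠ 0 := Function.ne_iff.1 hv
  have hvi : η (Sum.inl i) ≠ 0 := hηX _ (by simpa [ξ] using hi)
  have hwj : ∀ j, w j ≠ 0 → η (Sum.inr j) ≠ 0 := fun j hj => hηX _ (by simpa [ξ, hU0] using hj)
  obtain ⟨j₀, hj₀⟩ : ∃ j, w j ≠ 0 := hw01.elim (fun h => ⟨0, h⟩) fun h => ⟨1, h⟩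
  have hcomp : ∀ f, f ∈ 𝔮.comap (rename Sum.inr : MvPolynomial (Fin 3) k →ₐ[k]
      MvPolynomial (Fin 3 ⊕ Fin 3) k) → aeval (η ∘ Sum.inr) f = 0 := by
    intro f hf
    rw [← aeval_rename, ← hη]
    exact Ideal.algebraMap_residueField_eq_zero.2 hf
  obtain ⟨D, hD, hDw⟩ := exists_primeCurve_ideal_eq hw
    (P := 𝔮.comap (rename Sum.inr : MvPolynomial (Fin 3) k →ₐ[k] MvPolynomial (Fin 3 ⊕ Fin 3) k))
    -- A zero contraction would make the second set of coordinates algebraically independent, so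
    -- that the image would be the whole plane.
    (Ideal.IsPrime.comap _) (by
      intro hbot
      refine not_algebraicIndependent_of_conchoidIncident hdisc he hG hG0 ?_ hinc hGη ?_
      · exact fun h0 => hvi (congrFun h0 i)
      · rw [algebraicIndependent_iff]
        intro f hf
        rw [← Ideal.mem_bot, ← hbot, Ideal.mem_comap, ← Ideal.algebraMap_residueField_eq_zero, hη]
        exact (aeval_rename _ _ _).trans hf)
    (by
      intro f hf
      rw [← aeval_transcendental_smul_eq_zero_iff hU]
      have h1 : ψ (rename Sum.inr f) = 0 := h𝔮le hf
      exact (aeval_rename (Sum.inr : Fin 3 → Fin 3 ⊕ Fin 3) ξ f).symm.trans h1)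
  refine ⟨D, hDw, conchoid_ne_zero (𝔓 := 𝔮) ⟨h𝔮, ⟨i, ?_⟩, ⟨j₀, ?_⟩⟩ hD.symm ?_⟩
  · exact fun h0 => hvi (Ideal.algebraMap_residueField_eq_zero.2 h0)
  · exact fun h0 => hwj j₀ hj₀ (Ideal.algebraMap_residueField_eq_zero.2 h0)
  · refine pushDegree_ne_zero 𝔮 (isAlgebraic_div_of_conchoidIncident he hinc
      (hw01.imp (hwj 0) (hwj 1)) (hw'.imp ?_ (hwj 2)) ?_)
    · intro hq
      have h1 := hηne (C a * X (Sum.inr 0) ^ 2 + C b * X (Sum.inr 0) * X (Sum.inr 1) +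
        C c * X (Sum.inr 1) ^ 2)
      simp only [ψ, map_add, map_mul, map_pow, aeval_X, aeval_C] at h1
      refine h1 ?_
      have h2 : binaryForm a b c (ξ (Sum.inr 0)) (ξ (Sum.inr 1)) =
          U ^ 2 * algebraMap Ω K (binaryForm a b c (w 0) (w 1)) := by
        simp only [ξ, Sum.elim_inr, binaryForm_mul]
        simp only [binaryForm, map_add, map_mul, map_pow, ← IsScalarTower.algebraMap_apply k Ω K]
      exact h2.trans_ne (mul_ne_zero (pow_ne_zero 2 hU0) (by simpa using hq))
    · intro m n
      exact IntermediateField.subset_adjoin _ _ ⟨m, n, rfl⟩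

/-! ### Polar coordinates -/

/-- The columns of `m` are isotropic vectors for `a x² + b x y + c y²`, whose value under the
polarization of this form is `e`. -/
structure IsPolarFrame {k : Type*} [Field k] (a b c e : k) (m : Matrix (Fin 2) (Fin 2) k) : Prop where
  isotropic_zero : a * m 0 0 ^ 2 + b * m 0 0 * m 1 0 + c * m 1 0 ^ 2 = 0
  isotropic_one : a * m 0 1 ^ 2 + b * m 0 1 * m 1 1 + c * m 1 1 ^ 2 = 0
  polarization : 2 * a * m 0 0 * m 0 1 + b * (m 0 0 * m 1 1 + m 0 1 * m 1 0) +
    2 * c * m 1 0 * m 1 1 = e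
  det_ne_zero : m 0 0 * m 1 1 - m 0 1 * m 1 0 ≠ 0

/-- A square root of the discriminant gives two independent isotropic vectors, and rescaling the
first by `e / μ` adjusts the value `μ` of their polarization to `e`. -/
theorem exists_isPolarFrame {k : Type*} [Field k] [IsAlgClosed k] (h2 : (2 : k) ≠ 0) {a b c e : k}
    (hdisc : b ^ 2 - 4 * a * c ≠ 0) (he : e ≠ 0) : ∃ m, IsPolarFrame a b c e m := by
  have key : ∀ x y z w μ : k, a * x ^ 2 + b * x * y + c * y ^ 2 = 0 →
      a * z ^ 2 + b * z * w + c * w ^ 2 = 0 →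
      2 * a * x * z + b * (x * w + z * y) + 2 * c * y * w = μ → μ ≠ 0 → x * w - z * y ≠ 0 →
      ∃ m, IsPolarFrame a b c e m := by
    intro x y z w μ h1 h2 h3 h4 h5
    refine ⟨!![x * (e / μ), z; y * (e / μ), w], ⟨?_, ?_, ?_, ?_⟩⟩
    · simp; linear_combination (e / μ) ^ 2 * h1
    · simpa using h2
    · have h6 : e / μ * μ = e := div_mul_cancel₀ e h4
      simp; linear_combination (e / μ) * h3 + h6
    · have : x * (e / μ) * w - z * (y * (e / μ)) = (e / μ) * (x * w - z * y) := by ring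
      simp [this, he, h4, h5]
  by_cases ha : a = 0
  · subst ha
    have hb : b ≠ 0 := by rintro rfl; simp at hdisc
    refine key 1 0 (-c) b (b ^ 2) (by ring) (by ring) (by ring) (pow_ne_zero 2 hb) ?_
    simpa using hb
  · obtain ⟨d, hd⟩ := IsAlgClosed.exists_pow_nat_eq (b ^ 2 - 4 * a * c) (n := 2) (by norm_num)
    have hd0 : d ≠ 0 := by rintro rfl; simp [← hd] at hdisc
    refine key (-b + d) (2 * a) (-b - d) (2 * a) (-4 * a * (b ^ 2 - 4 * a * c)) ?_ ?_ ?_ ?_ ?_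
    · linear_combination a * hd
    · linear_combination a * hd
    · linear_combination -2 * a * hd
    · have h4 : (-4 : k) ≠ 0 := by
        have : (-4 : k) = -(2 * 2) := by norm_num
        rw [this]; exact neg_ne_zero.2 (mul_ne_zero h2 h2)
      exact mul_ne_zero (mul_ne_zero h4 ha) hdisc
    · have : (-b + d) * (2 * a) - (-b - d) * (2 * a) = 2 * 2 * a * d := by ring
      rw [this]
      exact mul_ne_zero (mul_ne_zero (mul_ne_zero h2 h2) ha) hd0

/-- The point with polar coordinates `s, t`: its radius is `s`, and its direction is given by `t`. -/
def polarPoint {k A : Type*} [Field k] [CommRing A] [Algebra k A] (m : Matrix (Fin 2) (Fin 2) k)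
    (s t : A) : Fin 3 → A :=
  ![s * (algebraMap k A (m 0 0) * t ^ 2 + algebraMap k A (m 0 1)),
    s * (algebraMap k A (m 1 0) * t ^ 2 + algebraMap k A (m 1 1)), t]

section Polar

variable {k : Type*} [Field k] {a b c e : k} {m : Matrix (Fin 2) (Fin 2) k}

theorem polarPoint_two {A : Type*} [CommRing A] [Algebra k A] (s t : A) : polarPoint m s t 2 = t :=
  rfl

theorem polarPoint_neg {A : Type*} [CommRing A] [Algebra k A] (s t : A) :
    polarPoint m (-s) (-t) = (-1 : A) • polarPoint m s t := by
  ext i; fin_cases i <;> simp [polarPoint]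

theorem IsPolarFrame.binaryForm_eq {A : Type*} [CommRing A] [Algebra k A]
    (hm : IsPolarFrame a b c e m) (p q : A) :
    binaryForm a b c (algebraMap k A (m 0 0) * p + algebraMap k A (m 0 1) * q)
      (algebraMap k A (m 1 0) * p + algebraMap k A (m 1 1) * q) = algebraMap k A e * p * q := by
  have h0 := congrArg (algebraMap k A) hm.isotropic_zero
  have h1 := congrArg (algebraMap k A) hm.isotropic_one
  have h2 := congrArg (algebraMap k A) hm.polarization
  simp only [map_add, map_mul, map_pow, map_zero, map_ofNat] at h0 h1 h2
  simp only [binaryForm]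
  linear_combination p ^ 2 * h0 + q ^ 2 * h1 + p * q * h2

theorem IsPolarFrame.binaryForm_polarPoint {A : Type*} [CommRing A] [Algebra k A]
    (hm : IsPolarFrame a b c e m) (s t : A) :
    binaryForm a b c (polarPoint m s t 0) (polarPoint m s t 1) =
      algebraMap k A e * s ^ 2 * t ^ 2 := by
  have := hm.binaryForm_eq (s * t ^ 2) s
  rw [show algebraMap k A e * s ^ 2 * t ^ 2 = algebraMap k A e * (s * t ^ 2) * s by ring, ← this]
  congr 1 <;> simp [polarPoint] <;> ring

theorem IsPolarFrame.aeval_centralConic_polarPoint {A : Type*} [CommRing A] [Algebra k A]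
    (hm : IsPolarFrame a b c e m) (e' : k) (s t : A) :
    aeval (polarPoint m s t) (centralConic a b c e') =
      (algebraMap k A e * s ^ 2 - algebraMap k A e') * t ^ 2 := by
  rw [aeval_centralConic, hm.binaryForm_polarPoint, polarPoint_two]; ring

/-- In one direction, the conchoid moves the radius by ±1; this is what polar coordinates are for.
-/
theorem IsPolarFrame.conchoidIncident {A : Type*} [CommRing A] [Algebra k A]
    (hm : IsPolarFrame a b c e m) {s s' : A} (t : A) (h : (s' - s) ^ 2 = 1) :
    ConchoidIncident a b c e (polarPoint m s t) (polarPoint m s' t) := by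
  constructor
  · have h1 := hm.binaryForm_polarPoint (t * (s' - s)) t
    have h2 : algebraMap k A e * (t * (s' - s)) ^ 2 * t ^ 2 = algebraMap k A e * (t * t) ^ 2 := by
      linear_combination algebraMap k A e * t ^ 4 * h
    rw [polarPoint_two, polarPoint_two, ← h2, ← h1]
    congr 1 <;> simp [polarPoint] <;> ring
  · simp [polarPoint]; ring

theorem IsPolarFrame.binaryForm_polarPoint_ne_zero {A : Type*} [Field A] [Algebra k A]
    (hm : IsPolarFrame a b c e m) (he : e ≠ 0) {s t : A} (hs : s ≠ 0) (ht : t ≠ 0) :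
    binaryForm a b c (polarPoint m s t 0) (polarPoint m s t 1) ≠ 0 := by
  rw [hm.binaryForm_polarPoint]
  simp [he, hs, ht]

theorem binaryForm_zero_zero {A : Type*} [CommRing A] [Algebra k A] :
    binaryForm a b c (0 : A) 0 = 0 := by
  simp [binaryForm]

theorem IsPolarFrame.polarPoint_ne_zero_or {A : Type*} [Field A] [Algebra k A]
    (hm : IsPolarFrame a b c e m) (he : e ≠ 0) {s t : A} (hs : s ≠ 0) (ht : t ≠ 0) :
    polarPoint m s t 0 ≠ 0 ∨ polarPoint m s t 1 ≠ 0 := by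
  by_contra! h
  have := hm.binaryForm_polarPoint_ne_zero he hs ht
  rw [h.1, h.2, binaryForm_zero_zero] at this
  exact this rfl

/-- If all ratios were algebraic, inverting `m` would make s t and s / t algebraic, hence s² and so
both s and t. -/
theorem IsPolarFrame.hasTranscendentalRatio {A : Type*} [Field A] [Algebra k A]
    (hm : IsPolarFrame a b c e m) {s t : A} (hs : s ≠ 0) (ht : t ≠ 0)
    (hst : Transcendental k s ∨ Transcendental k t) :
    HasTranscendentalRatio k (polarPoint m s t) := by
  by_contra h
  have halg : ∀ i, IsAlgebraic k (polarPoint m s t i / t) := by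
    intro i
    by_contra hi
    exact h ⟨i, 2, ht, hi⟩
  have h0 := halg 0
  have h1 := halg 1
  have hdet : algebraMap k A (m 0 0 * m 1 1 - m 0 1 * m 1 0) ≠ 0 :=
    (map_ne_zero _).2 hm.det_ne_zero
  have hc : ∀ r : k, IsAlgebraic k (algebraMap k A r) := fun r => isAlgebraic_algebraMap r
  have hst1 : IsAlgebraic k (s * t) := by
    have := (((hc (m 1 1)).mul h0).sub ((hc (m 0 1)).mul h1)).mul (hc (m 0 0 * m 1 1 - m 0 1 * m 1 0)).inv
    refine (?_ : _ = s * t) ▸ this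
    rw [mul_inv_eq_iff_eq_mul₀ hdet]
    simp only [polarPoint, Matrix.cons_val_zero, Matrix.cons_val_one, map_sub, map_mul]
    field_simp
    ring
  have hst2 : IsAlgebraic k (s / t) := by
    have := (((hc (m 0 0)).mul h1).sub ((hc (m 1 0)).mul h0)).mul (hc (m 0 0 * m 1 1 - m 0 1 * m 1 0)).inv
    refine (?_ : _ = s / t) ▸ this
    rw [mul_inv_eq_iff_eq_mul₀ hdet]
    simp only [polarPoint, Matrix.cons_val_zero, Matrix.cons_val_one, map_sub, map_mul]
    field_simp
    ring
  have hs' : IsAlgebraic k s := by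
    refine IsAlgebraic.of_pow (n := 2) (by norm_num) ?_
    have h2 : s ^ 2 = s * t * (s / t) := by field_simp
    exact h2 ▸ hst1.mul hst2
  have ht' : IsAlgebraic k t := by
    have h2 : t = s * t * s⁻¹ := by field_simp
    exact h2 ▸ hst1.mul hs'.inv
  exact hst.elim (· hs') (· ht')

/-- In the isotropic basis the first two coordinates become p and q with p q nonzero, and t is a
square root of p / q. -/
theorem IsPolarFrame.exists_eq_smul_polarPoint {A : Type*} [Field A] [Algebra k A] [IsAlgClosed A]
    (hm : IsPolarFrame a b c e m) {v : Fin 3 → A} (h2 : v 2 ≠ 0)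
    (hv : binaryForm a b c (v 0) (v 1) ≠ 0) :
    ∃ l s t : A, l ≠ 0 ∧ s ≠ 0 ∧ t ≠ 0 ∧ v = l • polarPoint m s t := by
  have hdet : algebraMap k A (m 0 0 * m 1 1 - m 0 1 * m 1 0) ≠ 0 :=
    (map_ne_zero _).2 hm.det_ne_zero
  set d := algebraMap k A (m 0 0 * m 1 1 - m 0 1 * m 1 0) with hd
  simp only [map_sub, map_mul] at hd
  obtain ⟨p, hp⟩ : ∃ p, p * d = algebraMap k A (m 1 1) * v 0 - algebraMap k A (m 0 1) * v 1 :=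
    ⟨_, div_mul_cancel₀ _ hdet⟩
  obtain ⟨q, hq⟩ : ∃ q, q * d = algebraMap k A (m 0 0) * v 1 - algebraMap k A (m 1 0) * v 0 :=
    ⟨_, div_mul_cancel₀ _ hdet⟩
  have hv0 : v 0 = algebraMap k A (m 0 0) * p + algebraMap k A (m 0 1) * q := by
    apply mul_right_cancel₀ hdet
    linear_combination -algebraMap k A (m 0 0) * hp - algebraMap k A (m 0 1) * hq + v 0 * hd
  have hv1 : v 1 = algebraMap k A (m 1 0) * p + algebraMap k A (m 1 1) * q := by
    apply mul_right_cancel₀ hdet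
    linear_combination -algebraMap k A (m 1 0) * hp - algebraMap k A (m 1 1) * hq + v 1 * hd
  rw [hv0, hv1, hm.binaryForm_eq] at hv
  have hp0 : p ≠ 0 := by rintro rfl; simp at hv
  have hq0 : q ≠ 0 := by rintro rfl; simp at hv
  obtain ⟨t, ht⟩ := IsAlgClosed.exists_pow_nat_eq (p / q) (n := 2) (by norm_num)
  have ht0 : t ≠ 0 := by
    rintro rfl
    exact div_ne_zero hp0 hq0 (by simpa using ht.symm)
  have hpt : p = q * t ^ 2 := by rw [ht]; field_simp
  refine ⟨v 2 / t, t * q / v 2, t, div_ne_zero h2 ht0, div_ne_zero (mul_ne_zero ht0 hq0) h2, ht0, ?_⟩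
  ext i; fin_cases i
  · simp only [Fin.zero_eta, hv0, polarPoint, Pi.smul_apply, smul_eq_mul, Matrix.cons_val_zero]
    rw [hpt]; field_simp
  · simp only [Fin.mk_one, hv1, polarPoint, Pi.smul_apply, smul_eq_mul, Matrix.cons_val_one,
      Matrix.cons_val_zero]
    rw [hpt]; field_simp
  · simp only [Fin.reduceFinMk, polarPoint_two, Pi.smul_apply, smul_eq_mul]
    field_simp

/-- Polynomials in the polar coordinates, up to powers of the coordinates, in terms of forms. -/
theorem IsPolarFrame.exists_forms.{u} (hm : IsPolarFrame a b c e m) (f : MvPolynomial (Fin 2) k) :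
    ∃ N : ℕ, ∀ n ≥ N, ∃ P Q : MvPolynomial (Fin 3) k, P.IsHomogeneous (2 * n) ∧
      Q.IsHomogeneous (2 * n) ∧ ∀ (A : Type u) [Field A] [Algebra k A] (s t : A),
        t * aeval (polarPoint m s t) P + aeval (polarPoint m s t) Q =
          s ^ n * t ^ (n + 1) * aeval ![s, t] f := by
  obtain ⟨d, hd⟩ : ∃ d, d = (m 0 0 * m 1 1 - m 0 1 * m 1 0)⁻¹ := ⟨_, rfl⟩
  have hd1 : d * (m 0 0 * m 1 1 - m 0 1 * m 1 0) = 1 := by rw [hd, inv_mul_cancel₀ hm.det_ne_zero]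
  -- The inverse of `m` gives linear forms `p` and `q` with values s t² and s at the polar point.
  obtain ⟨p, hp⟩ : ∃ p : MvPolynomial (Fin 3) k,
      p = C (d * m 1 1) * X 0 - C (d * m 0 1) * X 1 := ⟨_, rfl⟩
  obtain ⟨q, hq⟩ : ∃ q : MvPolynomial (Fin 3) k,
      q = C (d * m 0 0) * X 1 - C (d * m 1 0) * X 0 := ⟨_, rfl⟩
  have hp1 : p.IsHomogeneous 1 := hp ▸ (isHomogeneous_C_mul_X _ _).sub (isHomogeneous_C_mul_X _ _)
  have hq1 : q.IsHomogeneous 1 := hq ▸ (isHomogeneous_C_mul_X _ _).sub (isHomogeneous_C_mul_X _ _)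
  have hz1 := isHomogeneous_X k (2 : Fin 3)
  have hpv : ∀ (A : Type u) [Field A] [Algebra k A] (s t : A),
      aeval (polarPoint m s t) p = s * t ^ 2 := by
    intro A _ _ s t
    have := congrArg (algebraMap k A) hd1
    simp only [map_mul, map_sub, map_one] at this
    simp only [hp, polarPoint, map_sub, map_mul, aeval_C, aeval_X, Matrix.cons_val_zero,
      Matrix.cons_val_one]
    linear_combination s * t ^ 2 * this
  have hqv : ∀ (A : Type u) [Field A] [Algebra k A] (s t : A),
      aeval (polarPoint m s t) q = s := by
    intro A _ _ s t
    have := congrArg (algebraMap k A) hd1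
    simp only [map_mul, map_sub, map_one] at this
    simp only [hq, polarPoint, map_sub, map_mul, aeval_C, aeval_X, Matrix.cons_val_zero,
      Matrix.cons_val_one]
    linear_combination s * this
  have hzv : ∀ (A : Type u) [Field A] [Algebra k A] (s t : A),
      aeval (polarPoint m s t) (X 2 : MvPolynomial (Fin 3) k) = t := by
    intro A _ _ s t
    simp [polarPoint_two]
  induction f using MvPolynomial.induction_on with
  | C r =>
    refine ⟨0, fun n _ => ⟨C r * (q * X 2) ^ n, 0, ?_, isHomogeneous_zero _ _ _, ?_⟩⟩
    · simpa using (isHomogeneous_C (Fin 3) r).mul ((hq1.mul hz1).pow n)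
    · intro A _ _ s t
      simp only [map_mul, map_pow, hqv, hzv, aeval_C, map_zero]
      ring
  | add f g hf hg =>
    obtain ⟨N, hN⟩ := hf
    obtain ⟨N', hN'⟩ := hg
    refine ⟨max N N', fun n hn => ?_⟩
    obtain ⟨P, Q, hP, hQ, h⟩ := hN n (le_of_max_le_left hn)
    obtain ⟨P', Q', hP', hQ', h'⟩ := hN' n (le_of_max_le_right hn)
    refine ⟨P + P', Q + Q', hP.add hP', hQ.add hQ', fun A _ _ s t => ?_⟩
    simp only [map_add]
    linear_combination h A s t + h' A s t
  | mul_X f i hf =>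
    obtain ⟨N, hN⟩ := hf
    refine ⟨N + 1, fun n hn => ?_⟩
    obtain ⟨n, rfl⟩ : ∃ n', n = n' + 1 := ⟨n - 1, by omega⟩
    obtain ⟨P, Q, hP, hQ, h⟩ := hN n (by omega)
    have hdeg : 2 * (n + 1) = (1 + 1) + 2 * n := by ring
    rw [hdeg]
    fin_cases i
    -- `P` and `Q` have even degree, so t P is odd and Q even under (s, t) ↦ (-s, -t).
    -- Multiplication by a coordinate exchanges the two parts.
    · refine ⟨q * q * Q, p * q * P, (hq1.mul hq1).mul hQ, (hp1.mul hq1).mul hP, fun A _ _ s t => ?_⟩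
      simp only [map_mul, hqv, hpv, aeval_X, Fin.zero_eta, Matrix.cons_val_zero]
      linear_combination s ^ 2 * t * h A s t
    · refine ⟨q * X 2 * Q, p * X 2 * P, (hq1.mul hz1).mul hQ, (hp1.mul hz1).mul hP,
        fun A _ _ s t => ?_⟩
      simp only [map_mul, hqv, hpv, hzv, aeval_X, Fin.mk_one, Matrix.cons_val_one,
        Matrix.cons_val_zero]
      linear_combination s * t ^ 2 * h A s t

/-- Every polynomial in the polar coordinates that vanishes at `(s, t)` vanishes at `(s', t')`. -/
def PolarSpecializes (k : Type*) {A A' : Type*} [Field k] [CommRing A] [Algebra k A] [CommRing A']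
    [Algebra k A'] (s t : A) (s' t' : A') : Prop :=
  ∀ f : MvPolynomial (Fin 2) k, aeval ![s, t] f = 0 → aeval ![s', t'] f = 0

theorem PolarSpecializes.trans {A A' A'' : Type*} [CommRing A] [Algebra k A] [CommRing A']
    [Algebra k A'] [CommRing A''] [Algebra k A''] {s t : A} {s' t' : A'} {s'' t'' : A''}
    (h : PolarSpecializes k s t s' t') (h' : PolarSpecializes k s' t' s'' t'') :
    PolarSpecializes k s t s'' t'' :=
  fun f hf => h' f (h f hf)

theorem PolarSpecializes.add {A A' : Type*} [CommRing A] [Algebra k A] [CommRing A']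
    [Algebra k A'] {s t : A} {s' t' : A'} (h : PolarSpecializes k s t s' t') (r : ℤ) :
    PolarSpecializes k (s + r) t (s' + r) t' := by
  intro f hf
  have key : ∀ {B : Type _} [CommRing B] [Algebra k B] (x y : B),
      aeval ![x, y] (aeval ![X 0 + C (r : k), X 1] f : MvPolynomial (Fin 2) k) =
        aeval ![x + r, y] f := by
    intro B _ _ x y
    rw [← AlgHom.comp_apply, comp_aeval]
    congr 2
    ext i; fin_cases i <;> simp
  have key' : ∀ {B : Type _} [CommRing B] [Algebra k B] (x y : B),
      aeval ![x, y] (aeval ![X 0 + C (r : k), X 1] f : MvPolynomial (Fin 2) k) =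
        aeval ![x + r, y] f := by
    intro B _ _ x y
    rw [← AlgHom.comp_apply, comp_aeval]
    congr 2
    ext i; fin_cases i <;> simp
  rw [← key] at hf
  rw [← key']
  exact h _ hf

theorem PolarSpecializes.neg {A A' : Type*} [CommRing A] [Algebra k A] [CommRing A']
    [Algebra k A'] {s t : A} {s' t' : A'} (h : PolarSpecializes k s t s' t') :
    PolarSpecializes k (-s) (-t) (-s') (-t') := by
  intro f hf
  have key : ∀ {B : Type _} [CommRing B] [Algebra k B] (x y : B),
      aeval ![x, y] (aeval ![-X 0, -X 1] f : MvPolynomial (Fin 2) k) = aeval ![-x, -y] f := by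
    intro B _ _ x y
    rw [← AlgHom.comp_apply, comp_aeval]
    congr 2
    ext i; fin_cases i <;> simp
  have key' : ∀ {B : Type _} [CommRing B] [Algebra k B] (x y : B),
      aeval ![x, y] (aeval ![-X 0, -X 1] f : MvPolynomial (Fin 2) k) = aeval ![-x, -y] f := by
    intro B _ _ x y
    rw [← AlgHom.comp_apply, comp_aeval]
    congr 2
    ext i; fin_cases i <;> simp
  rw [← key] at hf
  rw [← key']
  exact h _ hf

theorem aeval_polarPoint {A : Type*} [CommRing A] [Algebra k A] (s t : A)
    (f : MvPolynomial (Fin 3) k) :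
    aeval (polarPoint m s t) f =
      aeval ![s, t] (aeval (polarPoint m (X 0) (X 1)) f : MvPolynomial (Fin 2) k) := by
  rw [← AlgHom.comp_apply, comp_aeval]
  congr 2
  ext i; fin_cases i <;> simp [polarPoint, MvPolynomial.algebraMap_eq]

theorem PolarSpecializes.through {A A' : Type*} [Field A] [Algebra k A] [Field A']
    [Algebra k A'] {s t : A} {s' t' : A'} (h : PolarSpecializes k s t s' t') {D : PrimeCurve k}
    (hD : D.Through (polarPoint m s t)) : D.Through (polarPoint m s' t') := by
  intro f hf
  have h1 := hD f hf
  rw [aeval_polarPoint] at h1 ⊢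
  exact h _ h1

theorem PrimeCurve.Through.smul {A : Type*} [Field A] [Algebra k A] {D : PrimeCurve k}
    {v : Fin 3 → A} (hD : D.Through v) (l : A) : D.Through (l • v) := by
  obtain ⟨d, H, hHd, -, hDH⟩ := D.exists_form
  intro f hf
  rw [hDH, Ideal.mem_span_singleton] at hf
  obtain ⟨g, rfl⟩ := hf
  rw [map_mul, aeval_smul_of_isHomogeneous hHd,
    hD H (hDH ▸ Ideal.mem_span_singleton_self H)]
  ring

theorem PrimeCurve.Through.neg_polarPoint {A : Type*} [Field A] [Algebra k A] {D : PrimeCurve k}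
    {s t : A} (hD : D.Through (polarPoint m s t)) : D.Through (polarPoint m (-s) (-t)) := by
  rw [polarPoint_neg]
  exact hD.smul _

/-- A curve determines the polar coordinates of its generic point up to the sign. -/
theorem IsPolarFrame.polarSpecializes_or.{u} [Infinite k] {A A' : Type u} [Field A] [Algebra k A]
    [Field A'] [Algebra k A'] (hm : IsPolarFrame a b c e m) {s t : A} {s' t' : A'}
    (hst : HasTranscendentalRatio k (polarPoint m s t)) (hs' : s' ≠ 0) (ht' : t' ≠ 0)
    {D : PrimeCurve k} (hD : D.Through (polarPoint m s t)) (hD' : D.Through (polarPoint m s' t')) :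
    PolarSpecializes k s t s' t' ∨ PolarSpecializes k s t (-s') (-t') := by
  have key : ∀ f : MvPolynomial (Fin 2) k, aeval ![s, t] f = 0 →
      aeval ![s', t'] f = 0 ∨ aeval ![-s', -t'] f = 0 := by
    intro f hf
    obtain ⟨n, hn⟩ := IsPolarFrame.exists_forms.{_, u} hm f
    obtain ⟨P, Q, hP, hQ, h⟩ := hn n le_rfl
    -- `R` is s times the norm (t P + Q)(t P - Q). Since s t² and s are values of linear forms, it
    -- is again a form, and the second factor is, up to sign, t P + Q at (-s, -t).
    obtain ⟨R, hR, hRv⟩ : ∃ R : MvPolynomial (Fin 3) k, R.IsHomogeneous (1 + 2 * n * 2) ∧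
        ∀ (B : Type u) [Field B] [Algebra k B] (x y : B), aeval (polarPoint m x y) R =
          x * (y * aeval (polarPoint m x y) P + aeval (polarPoint m x y) Q) *
            (y * aeval (polarPoint m x y) P - aeval (polarPoint m x y) Q) := by
      obtain ⟨d, hd⟩ : ∃ d, d = (m 0 0 * m 1 1 - m 0 1 * m 1 0)⁻¹ := ⟨_, rfl⟩
      have hd1 : d * (m 0 0 * m 1 1 - m 0 1 * m 1 0) = 1 := by
        rw [hd, inv_mul_cancel₀ hm.det_ne_zero]
      refine ⟨(C (d * m 1 1) * X 0 - C (d * m 0 1) * X 1) * P ^ 2 -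
        (C (d * m 0 0) * X 1 - C (d * m 1 0) * X 0) * Q ^ 2, ?_, ?_⟩
      · refine IsHomogeneous.sub ?_ ?_
        · exact ((isHomogeneous_C_mul_X _ _).sub (isHomogeneous_C_mul_X _ _)).mul (hP.pow 2)
        · exact ((isHomogeneous_C_mul_X _ _).sub (isHomogeneous_C_mul_X _ _)).mul (hQ.pow 2)
      · intro B _ _ x y
        have := congrArg (algebraMap k B) hd1
        simp only [map_mul, map_sub, map_one] at this
        have h0 : polarPoint m x y 0 =
            x * (algebraMap k B (m 0 0) * y ^ 2 + algebraMap k B (m 0 1)) := rfl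
        have h1 : polarPoint m x y 1 =
            x * (algebraMap k B (m 1 0) * y ^ 2 + algebraMap k B (m 1 1)) := rfl
        simp only [map_sub, map_mul, map_pow, aeval_C, aeval_X, h0, h1]
        linear_combination (x * y ^ 2 * aeval (polarPoint m x y) P ^ 2 -
          x * aeval (polarPoint m x y) Q ^ 2) * this
    have h1 : R ∈ D.ideal := by
      refine hD.mem hst hR ?_
      rw [hRv, h, hf]; ring
    have h2 := hD' R h1
    rw [hRv, mul_eq_zero, mul_eq_zero, or_assoc] at h2
    rcases h2.resolve_left hs' with h3 | h3
    · left
      rw [h] at h3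
      exact (mul_eq_zero.1 h3).resolve_left (mul_ne_zero (pow_ne_zero _ hs') (pow_ne_zero _ ht'))
    · right
      have h4 := h A' (-s') (-t')
      rw [polarPoint_neg, aeval_smul_of_isHomogeneous hP, aeval_smul_of_isHomogeneous hQ,
        pow_mul] at h4
      have h5 : (-s') ^ n * (-t') ^ (n + 1) * aeval ![-s', -t'] f = 0 := by
        rw [← h4]
        simp only [neg_one_sq, one_pow]
        linear_combination -h3
      exact (mul_eq_zero.1 h5).resolve_left
        (mul_ne_zero (pow_ne_zero _ (neg_ne_zero.2 hs')) (pow_ne_zero _ (neg_ne_zero.2 ht')))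
  -- The sign might depend on `f`; but an ideal contained in a union of two ideals lies in one of
  -- them.
  have hsub := Ideal.subset_union
    (I := RingHom.ker (aeval ![s, t] : MvPolynomial (Fin 2) k →ₐ[k] A))
    (J := RingHom.ker (aeval ![s', t'] : MvPolynomial (Fin 2) k →ₐ[k] A'))
    (K := RingHom.ker (aeval ![-s', -t'] : MvPolynomial (Fin 2) k →ₐ[k] A'))
  exact hsub.1 key

end Polar

/-! ### Degrees of components and asymptotic lines -/

section PrimeCurve

variable {k : Type*} [Field k]

theorem PrimeCurve.prime_of_ideal_eq {D : PrimeCurve k} {H : MvPolynomial (Fin 3) k}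
    (hH : D.ideal = Ideal.span {H}) : Prime H := by
  obtain ⟨d, H', -, hirr, hD⟩ := D.exists_form
  have h : Associated H H' := Ideal.span_singleton_eq_span_singleton.1 (hH.symm.trans hD)
  exact h.symm.prime hirr.prime

theorem PrimeCurve.isPrime (D : PrimeCurve k) : D.ideal.IsPrime := by
  obtain ⟨d, H, -, hirr, hD⟩ := D.exists_form
  rw [hD, Ideal.span_singleton_prime hirr.ne_zero]
  exact hirr.prime

theorem isUnit_of_totalDegree_eq_zero {σ : Type*} {f : MvPolynomial σ k} (hf : f ≠ 0)
    (h : f.totalDegree = 0) : IsUnit f := by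
  rw [totalDegree_eq_zero_iff_eq_C] at h
  rw [h]
  refine (isUnit_iff_ne_zero.2 fun h0 => hf ?_).map C
  rw [h, h0, C_0]

theorem PrimeCurve.totalDegree_pos {D : PrimeCurve k} {H : MvPolynomial (Fin 3) k}
    (hH : D.ideal = Ideal.span {H}) : 0 < H.totalDegree := by
  have hp := PrimeCurve.prime_of_ideal_eq hH
  exact Nat.pos_of_ne_zero fun h => hp.not_isUnit (isUnit_of_totalDegree_eq_zero hp.ne_zero h)

theorem PrimeCurve.ideal_eq_span_of_totalDegree_le {D : PrimeCurve k}
    {H f : MvPolynomial (Fin 3) k} (hH : D.ideal = Ideal.span {H}) (hf : f ∈ D.ideal) (hf0 : f ≠ 0)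
    (hdeg : f.totalDegree ≤ H.totalDegree) : D.ideal = Ideal.span {f} := by
  rw [hH, Ideal.mem_span_singleton] at hf
  obtain ⟨g, rfl⟩ := hf
  rw [totalDegree_mul_of_isDomain (left_ne_zero_of_mul hf0) (right_ne_zero_of_mul hf0)] at hdeg
  have hg := isUnit_of_totalDegree_eq_zero (right_ne_zero_of_mul hf0) (by omega)
  rw [hH, Ideal.span_singleton_mul_right_unit hg]

theorem PrimeCurve.ideal_eq_span_of_totalDegree_le_one {D : PrimeCurve k}
    {f : MvPolynomial (Fin 3) k} (hf : f ∈ D.ideal) (hf0 : f ≠ 0) (hdeg : f.totalDegree ≤ 1) :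
    D.ideal = Ideal.span {f} := by
  obtain ⟨d, H, -, -, hD⟩ := D.exists_form
  exact D.ideal_eq_span_of_totalDegree_le hD hf hf0 (hdeg.trans (D.totalDegree_pos hD))

theorem PrimeCurve.mul_dvd {D₁ D₂ : PrimeCurve k} (hne : D₁ ≠ D₂) {H₁ H₂ G : MvPolynomial (Fin 3) k}
    (h₁ : D₁.ideal = Ideal.span {H₁}) (h₂ : D₂.ideal = Ideal.span {H₂}) (hG₁ : G ∈ D₁.ideal)
    (hG₂ : G ∈ D₂.ideal) : H₁ * H₂ ∣ G := by
  have hp₁ := PrimeCurve.prime_of_ideal_eq h₁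
  have hp₂ := PrimeCurve.prime_of_ideal_eq h₂
  rw [h₁, Ideal.mem_span_singleton] at hG₁
  obtain ⟨U, rfl⟩ := hG₁
  rw [h₂, Ideal.mem_span_singleton] at hG₂
  refine mul_dvd_mul_left _ ((hp₂.dvd_or_dvd hG₂).resolve_left fun h => hne ?_)
  have hass := hp₂.irreducible.associated_of_dvd hp₁.irreducible h
  exact PrimeCurve.ext (by rw [h₁, h₂, Ideal.span_singleton_eq_span_singleton]; exact hass.symm)

theorem PrimeCurve.totalDegree_add_le {D₁ D₂ : PrimeCurve k} (hne : D₁ ≠ D₂)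
    {H₁ H₂ G : MvPolynomial (Fin 3) k} (h₁ : D₁.ideal = Ideal.span {H₁})
    (h₂ : D₂.ideal = Ideal.span {H₂}) (hG₁ : G ∈ D₁.ideal) (hG₂ : G ∈ D₂.ideal) (hG0 : G ≠ 0) :
    H₁.totalDegree + H₂.totalDegree ≤ G.totalDegree := by
  obtain ⟨U, rfl⟩ := PrimeCurve.mul_dvd hne h₁ h₂ hG₁ hG₂
  rw [totalDegree_mul_of_isDomain (left_ne_zero_of_mul hG0) (right_ne_zero_of_mul hG0),
    totalDegree_mul_of_isDomain (PrimeCurve.prime_of_ideal_eq h₁).ne_zero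
      (PrimeCurve.prime_of_ideal_eq h₂).ne_zero]
  omega

theorem totalDegree_centralConic {a b c e : k} (he : e ≠ 0) :
    (centralConic a b c e).totalDegree = 2 :=
  (isHomogeneous_centralConic a b c e).totalDegree (centralConic_ne_zero he)

theorem IsAsymptoticLine.binaryForm_eq_zero {Ω : Type*} [Field Ω] [Algebra k Ω] {a b c e : k}
    {D : PrimeCurve k} (h : IsAsymptoticLine (centralConic a b c e) D) {w : Fin 3 → Ω}
    (hD : D.Through w) : binaryForm a b c (w 0) (w 1) = 0 := by
  obtain ⟨α, β, hne, hF, hD'⟩ := h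
  have h1 := hD _ (hD' ▸ Ideal.mem_span_singleton_self _)
  simp only [map_sub, map_mul, aeval_C, aeval_X] at h1
  have h2 : a * α ^ 2 + b * α * β + c * β ^ 2 = 0 := by simpa [centralConic] using hF
  have h3 := congrArg (algebraMap k Ω) h2
  simp only [map_add, map_mul, map_pow, map_zero] at h3
  simp only [binaryForm]
  rcases hne with h0 | h0
  · have h0' : algebraMap k Ω α ^ 2 ≠ 0 := pow_ne_zero 2 (by simpa using h0)
    apply (mul_eq_zero.1 _).resolve_left h0'
    have h4 : algebraMap k Ω α * w 1 = algebraMap k Ω β * w 0 := by linear_combination -h1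
    linear_combination w 0 ^ 2 * h3 + (algebraMap k Ω b * algebraMap k Ω α * w 0 +
      algebraMap k Ω c * (algebraMap k Ω α * w 1 + algebraMap k Ω β * w 0)) * h4
  · have h0' : algebraMap k Ω β ^ 2 ≠ 0 := pow_ne_zero 2 (by simpa using h0)
    apply (mul_eq_zero.1 _).resolve_left h0'
    have h4 : algebraMap k Ω β * w 0 = algebraMap k Ω α * w 1 := by linear_combination h1
    linear_combination w 1 ^ 2 * h3 + (algebraMap k Ω b * algebraMap k Ω β * w 1 +
      algebraMap k Ω a * (algebraMap k Ω β * w 0 + algebraMap k Ω α * w 1)) * h4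

end PrimeCurve

/-! ### Polar generic points and components of the proper conchoid -/

section Components

variable {k : Type*} [Field k] {a b c e : k} {m : Matrix (Fin 2) (Fin 2) k}

/-- A curve other than the line at infinity and the asymptotic lines has a generic point with polar
coordinates. -/
theorem IsPolarFrame.exists_through_polarPoint.{u} {k : Type u} [Field k] [IsAlgClosed k]
    {a b c e : k} {m : Matrix (Fin 2) (Fin 2) k} (hm : IsPolarFrame a b c e m)
    (he : e ≠ 0) {D : PrimeCurve k} (hX : X 2 ∉ D.ideal)
    (hD : ¬ IsAsymptoticLine (centralConic a b c e) D) :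
    ∃ (Ω : Type u) (_ : Field Ω) (_ : Algebra k Ω) (s t : Ω), s ≠ 0 ∧ t ≠ 0 ∧
      (Transcendental k s ∨ Transcendental k t) ∧ D.Through (polarPoint m s t) := by
  have := D.isPrime
  let κ := D.ideal.ResidueField
  let Ω := AlgebraicClosure κ
  let η : Fin 3 → κ := fun i => algebraMap (MvPolynomial (Fin 3) k) κ (X i)
  let v : Fin 3 → Ω := fun i => algebraMap κ Ω (η i)
  have hη : ∀ f, algebraMap (MvPolynomial (Fin 3) k) κ f = aeval η f := by
    intro f
    have : IsScalarTower.toAlgHom k (MvPolynomial (Fin 3) k) κ = aeval η :=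
      MvPolynomial.algHom_ext fun i => by simp [η]
    exact congrArg (fun g => g f) this
  have hmem : ∀ f, f ∈ D.ideal ↔ aeval v f = 0 := by
    intro f
    rw [show aeval v f = algebraMap κ Ω (aeval η f) from aeval_algebraMap_apply Ω η f, ← hη,
      map_eq_zero, Ideal.algebraMap_residueField_eq_zero]
  have hv2 : v 2 ≠ 0 := by
    intro h
    exact hX ((hmem _).2 (by simpa using h))
  have hlin : ∀ α β : k, (α ≠ 0 ∨ β ≠ 0) → a * α ^ 2 + b * α * β + c * β ^ 2 = 0 →
      algebraMap k Ω β * v 0 - algebraMap k Ω α * v 1 ≠ 0 := by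
    intro α β hne h0 h1
    have h2 : C β * X 0 - C α * X 1 ∈ D.ideal := (hmem _).2 (by simpa using h1)
    refine hD ⟨α, β, hne, by simpa [centralConic] using h0,
      D.ideal_eq_span_of_totalDegree_le_one h2 ?_ ?_⟩
    · intro h3
      have e0 := congrArg (eval ![1, 0, 0]) h3
      have e1 := congrArg (eval ![0, 1, 0]) h3
      simp at e0 e1
      exact hne.elim (fun h => h e1) fun h => h e0
    · exact ((isHomogeneous_C_mul_X β 0).sub (isHomogeneous_C_mul_X α 1)).totalDegree_le
  -- The form is, up to a nonzero factor, the product of the equations of the two asymptotic lines,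
  -- neither of which vanishes on `D`.
  have hq : binaryForm a b c (v 0) (v 1) ≠ 0 := by
    have hp0 := hlin (m 0 1) (m 1 1) (by
      by_contra! h
      exact hm.det_ne_zero (by rw [h.1, h.2]; ring)) hm.isotropic_one
    have hq0 := hlin (m 0 0) (m 1 0) (by
      by_contra! h
      exact hm.det_ne_zero (by rw [h.1, h.2]; ring)) hm.isotropic_zero
    have h1 := hm.binaryForm_eq (algebraMap k Ω (m 1 1) * v 0 - algebraMap k Ω (m 0 1) * v 1)
      (-(algebraMap k Ω (m 1 0) * v 0 - algebraMap k Ω (m 0 0) * v 1))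
    have h2 : binaryForm a b c
        (algebraMap k Ω (m 0 0 * m 1 1 - m 0 1 * m 1 0) * v 0)
        (algebraMap k Ω (m 0 0 * m 1 1 - m 0 1 * m 1 0) * v 1) =
        algebraMap k Ω e * (algebraMap k Ω (m 1 1) * v 0 - algebraMap k Ω (m 0 1) * v 1) *
        (-(algebraMap k Ω (m 1 0) * v 0 - algebraMap k Ω (m 0 0) * v 1)) := by
      rw [← h1]
      congr 1 <;> simp only [map_sub, map_mul] <;> ring
    rw [binaryForm_mul] at h2
    intro h0
    rw [h0, mul_zero] at h2
    exact mul_ne_zero (mul_ne_zero ((map_ne_zero _).2 he) hp0) (neg_ne_zero.2 hq0) h2.symm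
  obtain ⟨l, s, t, hl, hs, ht, hv⟩ := hm.exists_eq_smul_polarPoint hv2 hq
  refine ⟨Ω, inferInstance, inferInstance, s, t, hs, ht, ?_, ?_⟩
  -- Otherwise s and t lie in `k`, and the ideal of `D` contains two independent linear forms, as
  -- for a single point.
  · by_contra! hst
    simp only [Transcendental, not_not] at hst
    have hrange : ∀ x : Ω, IsAlgebraic k x → ∃ y, algebraMap k Ω y = x := fun x hx =>
      minpoly.mem_range_of_degree_eq_one k x
        (IsAlgClosed.degree_eq_one_of_irreducible k (minpoly.irreducible hx.isIntegral))
    obtain ⟨s₀, rfl⟩ := hrange s hst.1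
    obtain ⟨t₀, rfl⟩ := hrange t hst.2
    have ht₀ : t₀ ≠ 0 := by rintro rfl; simp at ht
    have hmem' : ∀ i α, polarPoint m (algebraMap k Ω s₀) (algebraMap k Ω t₀) i = algebraMap k Ω α →
        C t₀ * X i - C α * X 2 ∈ D.ideal := by
      intro i α h
      rw [hmem, hv]
      simp only [map_sub, map_mul, aeval_C, aeval_X, Pi.smul_apply, smul_eq_mul, polarPoint_two, h]
      ring
    have h0 := hmem' 0 (s₀ * (m 0 0 * t₀ ^ 2 + m 0 1)) (by simp [polarPoint])
    have h1 := hmem' 1 (s₀ * (m 1 0 * t₀ ^ 2 + m 1 1)) (by simp [polarPoint])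
    rw [D.ideal_eq_span_of_totalDegree_le_one h1 ?_
      ((isHomogeneous_C_mul_X _ 1).sub (isHomogeneous_C_mul_X _ 2)).totalDegree_le,
      Ideal.mem_span_singleton] at h0
    · obtain ⟨g, hg⟩ := h0
      have := congrArg (eval ![1, 0, 0]) hg
      simp [ht₀] at this
    · intro h
      have := congrArg (eval ![0, 1, 0]) h
      simp [ht₀] at this
  · intro f hf
    have h1 : D.Through v := fun f hf => (hmem f).1 hf
    have h2 := h1.smul l⁻¹
    rw [hv, smul_smul, inv_mul_cancel₀ hl, one_smul] at h2
    exact h2 f hf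

/-- A curve through a generic point of constant radius is a conic. -/
theorem IsPolarFrame.ideal_eq_span_centralConic [Infinite k] {Ω : Type*} [Field Ω] [Algebra k Ω]
    (hm : IsPolarFrame a b c e m) (he : e ≠ 0) {r : k} (hr : r ≠ 0) {t : Ω}
    (ht : Transcendental k t) {D : PrimeCurve k}
    (hD : D.Through (polarPoint m (algebraMap k Ω r) t)) :
    D.ideal = Ideal.span {centralConic a b c (r ^ 2 * e)} := by
  have ht0 : t ≠ 0 := by rintro rfl; exact ht isAlgebraic_zero
  have hre : r ^ 2 * e ≠ 0 := mul_ne_zero (pow_ne_zero 2 hr) he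
  have hw := hm.hasTranscendentalRatio ((map_ne_zero (algebraMap k Ω)).2 hr) ht0 (Or.inr ht)
  obtain ⟨d, H, hHd, hirr, hDH⟩ := D.exists_form
  refine D.ideal_eq_span_of_totalDegree_le hDH
    (hD.mem hw (isHomogeneous_centralConic a b c _) ?_) (centralConic_ne_zero hre) ?_
  · rw [hm.aeval_centralConic_polarPoint, map_mul, map_pow]; ring
  · rw [totalDegree_centralConic hre]
    by_contra! hlt
    have hpos := D.totalDegree_pos hDH
    have hd1 : H.totalDegree = 1 := by omega
    rw [hHd.totalDegree hirr.ne_zero] at hd1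
    subst hd1
    rw [← mem_homogeneousSubmodule, homogeneousSubmodule_one_eq_span_X,
      Submodule.mem_span_range_iff_exists_fun] at hHd
    obtain ⟨x, rfl⟩ := hHd
    have h1 := hD _ (hDH ▸ Ideal.mem_span_singleton_self _)
    -- At constant radius a linear form becomes a quadratic polynomial in the transcendental t, so
    -- its coefficients vanish and `D` is not a line.
    have h2 : Polynomial.C (r * (x 0 * m 0 0 + x 1 * m 1 0)) * Polynomial.X ^ 2 +
        Polynomial.C (x 2) * Polynomial.X + Polynomial.C (r * (x 0 * m 0 1 + x 1 * m 1 1)) = 0 := by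
      apply (transcendental_iff.1 ht)
      simp only [Fin.sum_univ_three, map_add, map_mul, map_pow, Polynomial.aeval_C,
        Polynomial.aeval_X, polarPoint, Algebra.smul_def, MvPolynomial.algebraMap_eq, aeval_C,
        aeval_X, Matrix.cons_val_zero, Matrix.cons_val_one, Matrix.cons_val] at h1 ⊢
      linear_combination h1
    have hcoeff : ∀ x y z : k, Polynomial.C x * Polynomial.X ^ 2 + Polynomial.C y * Polynomial.X +
        Polynomial.C z = 0 → x = 0 ∧ y = 0 ∧ z = 0 := by
      intro x y z h
      have h0 := congrArg (fun p => Polynomial.coeff p 0) h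
      have h1 := congrArg (fun p => Polynomial.coeff p 1) h
      have h2 := congrArg (fun p => Polynomial.coeff p 2) h
      simp [Polynomial.coeff_X, Polynomial.coeff_C] at h0 h1 h2
      exact ⟨h2, h1, h0⟩
    obtain ⟨c2, c1, c0⟩ := hcoeff _ _ _ h2
    replace c2 := (mul_eq_zero.1 c2).resolve_left hr
    replace c0 := (mul_eq_zero.1 c0).resolve_left hr
    have hx0 : x 0 = 0 := by
      apply (mul_eq_zero.1 _).resolve_right hm.det_ne_zero
      linear_combination m 1 1 * c2 - m 1 0 * c0
    have hx1 : x 1 = 0 := by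
      apply (mul_eq_zero.1 _).resolve_right hm.det_ne_zero
      linear_combination m 0 0 * c0 - m 0 1 * c2
    exact hirr.ne_zero (by simp [Fin.sum_univ_three, hx0, hx1, c1])

/-- The translations of the radius by `1` and `-1` give components of the proper conchoid. -/
theorem IsPolarFrame.exists_mem_cycleComponents [Infinite k] {Ω : Type*} [Field Ω] [Algebra k Ω]
    (hm : IsPolarFrame a b c e m) (hdisc : b ^ 2 - 4 * a * c ≠ 0) (he : e ≠ 0)
    {G : MvPolynomial (Fin 3) k} {δ : ℕ} (hG : G.IsHomogeneous δ) (hG0 : G ≠ 0) {s s' t : Ω}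
    (ht : t ≠ 0) (hst : Transcendental k s' ∨ Transcendental k t)
    (hs' : s' ≠ 0 ∧ s' ≠ 1 ∧ s' ≠ -1) (hss' : (s' - s) ^ 2 = 1) {D : PrimeCurve k}
    (hGD : G ∈ D.ideal) (hD : D.Through (polarPoint m s t)) :
    ∃ E ∈ cycleComponents (properConchoid (centralConic a b c e) G),
      E.Through (polarPoint m s' t) := by
  have hw := hm.hasTranscendentalRatio hs'.1 ht hst
  have hq := hm.binaryForm_polarPoint_ne_zero he hs'.1 ht
  obtain ⟨E, hE, hE0⟩ := exists_through_conchoid_ne_zero hdisc he hG hG0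
    (v := polarPoint m s t) (fun h => ht (congrFun h 2)) hw (hm.conchoidIncident t hss') (hD G hGD)
    (hm.polarPoint_ne_zero_or he hs'.1 ht) (Or.inl hq)
  refine ⟨E, ?_, hE⟩
  rw [cycleComponents, Set.mem_ofPred_eq, properConchoid, if_neg]
  · exact hE0
  · rintro (h | h)
    · have h1 := hE _ (h ▸ Ideal.mem_span_singleton_self _)
      rw [hm.aeval_centralConic_polarPoint] at h1
      have he' : algebraMap k Ω e ≠ 0 := (map_ne_zero _).2 he
      have h2 : algebraMap k Ω e * t ^ 2 * ((s' - 1) * (s' + 1)) = 0 := by linear_combination h1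
      rcases mul_eq_zero.1 ((mul_eq_zero.1 h2).resolve_left
        (mul_ne_zero he' (pow_ne_zero 2 ht))) with h3 | h3
      · exact hs'.2.1 (sub_eq_zero.1 h3)
      · exact hs'.2.2 (eq_neg_of_add_eq_zero_left h3)
    · exact hq (h.binaryForm_eq_zero hE)

end Components

/-! ### Translations of the radius -/

section Translation

variable {k : Type*} [Field k] {a b c e : k} {m : Matrix (Fin 2) (Fin 2) k}

theorem exists_natCast_mul_eq_two_or_injective {k : Type*} [Field k] (h2 : (2 : k) ≠ 0) {r : ℤ}
    (hr : r = 2 ∨ r = -2 ∨ r = 4) :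
    (∃ n : ℕ, (n : ℤ) * (r : k) = 2) ∨ Function.Injective (fun n : ℕ => (n : k)) := by
  obtain ⟨p, hp⟩ := CharP.exists k
  rcases CharP.char_is_prime_or_zero k p with hprime | rfl
  · left
    have hpk : (p : k) = 0 := CharP.cast_eq_zero k p
    have hodd : p % 2 = 1 := hprime.eq_two_or_odd.resolve_left fun h => h2 (by
      subst h; exact_mod_cast hpk)
    rcases hr with rfl | rfl | rfl
    · exact ⟨1, by simp⟩
    -- In characteristic p, p - 1 represents -1, and (p + 1) / 2 below represents 1 / 2.
    · refine ⟨p - 1, ?_⟩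
      have : ((p - 1 : ℕ) : k) = p - 1 := by rw [Nat.cast_sub hprime.one_le, Nat.cast_one]
      push_cast
      rw [this, hpk]; ring
    · refine ⟨(p + 1) / 2, ?_⟩
      have h : 2 * ((p + 1) / 2) = p + 1 := by omega
      have h' := congrArg (Nat.cast : ℕ → k) h
      rw [Nat.cast_mul, Nat.cast_add, Nat.cast_one, Nat.cast_ofNat] at h'
      rw [Int.cast_natCast, Int.cast_ofNat]
      linear_combination 2 * h' + 2 * hpk
  · right
    have := CharP.charP_to_charZero k
    exact Nat.cast_injective

theorem PolarSpecializes.nsmul {Ω : Type*} [Field Ω] [Algebra k Ω] {s t : Ω} {r : ℤ}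
    (h : PolarSpecializes k s t (s + r) t) (n : ℕ) :
    PolarSpecializes k s t (s + (n : ℤ) * r) t := by
  induction n with
  | zero => intro f hf; simpa using hf
  | succ n ih =>
    refine ih.trans ?_
    have h1 := h.add ((n : ℤ) * r)
    have e1 : s + (((n : ℤ) * r : ℤ) : Ω) = s + (n : ℤ) * r := by push_cast; ring
    have e2 : s + (r : Ω) + (((n : ℤ) * r : ℤ) : Ω) = s + ((n + 1 : ℕ) : ℤ) * r := by
      push_cast; ring
    rwa [e1, e2] at h1

/-- If a translation of the radius maps a point to a specialization of it, then the curve through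
the point is the curve through its translation by `2`. -/
theorem IsPolarFrame.eq_of_polarSpecializes_add [Infinite k] {Ω : Type*} [Field Ω] [Algebra k Ω]
    (hm : IsPolarFrame a b c e m) (h2 : (2 : k) ≠ 0) {r : ℤ} (hr : r = 2 ∨ r = -2 ∨ r = 4) {s t : Ω}
    (hs : s + 1 ≠ 0) (ht : t ≠ 0) (hst : Transcendental k (s + 1) ∨ Transcendental k t)
    (h : PolarSpecializes k s t (s + r) t) {D₁ D₂ : PrimeCurve k}
    (hD₁ : D₁.Through (polarPoint m (s - 1) t)) (hD₂ : D₂.Through (polarPoint m (s + 1) t)) :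
    D₁ = D₂ := by
  have hw := hm.hasTranscendentalRatio hs ht hst
  have key : ∀ n : ℕ, D₁.Through (polarPoint m (s - 1 + (n : ℤ) * r) t) := by
    intro n
    have h1 := (h.nsmul n).add (-1)
    have e1 : s + ((-1 : ℤ) : Ω) = s - 1 := by push_cast; ring
    have e2 : s + (n : ℤ) * r + ((-1 : ℤ) : Ω) = s - 1 + (n : ℤ) * r := by push_cast; ring
    rw [e1, e2] at h1
    exact h1.through hD₁
  rcases exists_natCast_mul_eq_two_or_injective h2 hr with ⟨n, hn⟩ | hinj
  · have h1 := key n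
    have h3 := congrArg (algebraMap k Ω) hn
    simp only [map_mul, map_intCast, map_ofNat] at h3
    rw [h3, show s - 1 + 2 = s + 1 by ring] at h1
    exact h1.eq hD₂ hw
  -- With t fixed, each equation of `D₁` is a polynomial in the radius with infinitely many zeros,
  -- so it vanishes at every radius.
  · refine PrimeCurve.Through.eq (w := polarPoint m (s + 1) t) (fun f hf => ?_) hD₂ hw
    let p : Polynomial Ω := aeval (polarPoint m Polynomial.X (Polynomial.C t)) f
    have hp : ∀ x, p.eval x = aeval (polarPoint m x t) f := by
      intro x
      change ((Polynomial.aeval x : Polynomial Ω →ₐ[Ω] Ω).restrictScalars k) p = _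
      rw [← AlgHom.comp_apply, comp_aeval]
      congr 2
      ext i; fin_cases i <;> simp [polarPoint]
    have hp0 : p = 0 := by
      refine Polynomial.eq_zero_of_infinite_isRoot p
        ((Set.infinite_range_of_injective (f := fun n : ℕ => s - 1 + (n : ℤ) * (r : Ω)) ?_).mono ?_)
      · intro n n' hnn
        have hr0 : (r : k) ≠ 0 := by
          have h4 : (2 : k) * 2 ≠ 0 := mul_ne_zero h2 h2
          rcases hr with rfl | rfl | rfl
          · simpa using h2
          · simpa using h2
          · intro h; apply h4; push_cast at h; linear_combination h
        have hr0' : (r : Ω) ≠ 0 := by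
          have := (map_ne_zero (algebraMap k Ω)).2 hr0
          rwa [map_intCast] at this
        have h1 := mul_right_cancel₀ hr0' (add_left_cancel hnn)
        apply hinj
        apply (algebraMap k Ω).injective
        simpa using h1
      · rintro _ ⟨n, rfl⟩
        change p.eval _ = 0
        rw [hp]
        exact key n f hf
    rw [← hp, hp0, Polynomial.eval_zero]

/-- The two conics already use up degree 4, so the cofactor is constant. This identifies the
excluded curve in characteristic 5. -/
theorem associated_mul_of_totalDegree_le {D₁ D₂ : PrimeCurve k} (hne : D₁ ≠ D₂) {e₁ e₂ : k}
    (he₁ : e₁ ≠ 0) (he₂ : e₂ ≠ 0) {G : MvPolynomial (Fin 3) k}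
    (h₁ : D₁.ideal = Ideal.span {centralConic a b c e₁})
    (h₂ : D₂.ideal = Ideal.span {centralConic a b c e₂}) (hG₁ : G ∈ D₁.ideal) (hG₂ : G ∈ D₂.ideal)
    (hG0 : G ≠ 0) (hdeg : G.totalDegree < 5) :
    Associated G (centralConic a b c e₁ * centralConic a b c e₂) := by
  obtain ⟨U, hU⟩ := PrimeCurve.mul_dvd hne h₁ h₂ hG₁ hG₂
  have hU0 : U ≠ 0 := by rintro rfl; simp [hU] at hG0
  have c₁ := centralConic_ne_zero (a := a) (b := b) (c := c) he₁
  have c₂ := centralConic_ne_zero (a := a) (b := b) (c := c) he₂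
  have hUd : U.totalDegree = 0 := by
    rw [hU, totalDegree_mul_of_isDomain (mul_ne_zero c₁ c₂) hU0, totalDegree_mul_of_isDomain c₁ c₂,
      totalDegree_centralConic he₁, totalDegree_centralConic he₂] at hdeg
    omega
  exact hU ▸ (associated_mul_unit_right _ _ (isUnit_of_totalDegree_eq_zero hU0 hUd)).symm

end Translation

/-! ### Excluding a single component -/

section Reducible

variable {k : Type*} [Field k] {a b c e : k} {m : Matrix (Fin 2) (Fin 2) k}

theorem IsPolarFrame.ideal_eq_span_of_intCast [Infinite k] {Ω : Type*} [Field Ω] [Algebra k Ω]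
    (hm : IsPolarFrame a b c e m) (he : e ≠ 0) {r : ℤ} (hr : (r : k) ≠ 0) {s t : Ω}
    (hs : s = (r : Ω)) (hst : Transcendental k s ∨ Transcendental k t) {D : PrimeCurve k}
    (hD : D.Through (polarPoint m s t)) :
    D.ideal = Ideal.span {centralConic a b c ((r : k) ^ 2 * e)} := by
  rw [← map_intCast (algebraMap k Ω) r] at hs
  subst hs
  exact hm.ideal_eq_span_centralConic he hr
    (hst.resolve_left fun h => h (isAlgebraic_algebraMap _)) hD

theorem three_le_totalDegree {D₁ D₂ : PrimeCurve k} (hne : D₁ ≠ D₂) {e' : k} (he' : e' ≠ 0)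
    {G : MvPolynomial (Fin 3) k} (h₂ : D₂.ideal = Ideal.span {centralConic a b c e'})
    (hG₁ : G ∈ D₁.ideal) (hG₂ : G ∈ D₂.ideal) (hG0 : G ≠ 0) : 3 ≤ G.totalDegree := by
  obtain ⟨d, H, -, -, hH⟩ := D₁.exists_form
  have h1 := PrimeCurve.totalDegree_add_le hne hH h₂ hG₁ hG₂ hG0
  have h2 := D₁.totalDegree_pos hH
  rw [totalDegree_centralConic he'] at h1
  omega

theorem transcendental_add_intCast {Ω : Type*} [Field Ω] [Algebra k Ω] {s t : Ω}
    (hst : Transcendental k s ∨ Transcendental k t) (r : ℤ) :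
    Transcendental k (s + r) ∨ Transcendental k t := by
  refine hst.imp_left fun h halg => h ?_
  have h1 : IsAlgebraic k (r : Ω) := by
    rw [← map_intCast (algebraMap k Ω) r]
    exact isAlgebraic_algebraMap _
  simpa using halg.sub h1

/-- The case where the translation of one of two components by `2` does not give a component of the
proper conchoid. -/
theorem IsPolarFrame.false_of_add_two [Infinite k] {Ω : Type*} [Field Ω] [Algebra k Ω]
    (hm : IsPolarFrame a b c e m) (hdisc : b ^ 2 - 4 * a * c ≠ 0) (he : e ≠ 0)
    {G : MvPolynomial (Fin 3) k} {δ : ℕ} (hG : G.IsHomogeneous δ) (hG0 : G ≠ 0) (h2 : (2 : k) ≠ 0)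
    (h3 : (3 : k) = 0 → δ < 3)
    (h5 : (5 : k) = 0 →
      δ < 5 ∧ ¬ Associated G (centralConic a b c e * centralConic a b c (4 * e)))
    (hsub : (cycleComponents (properConchoid (centralConic a b c e) G)).Subsingleton)
    {s t : Ω} (ht : t ≠ 0) (hst : Transcendental k s ∨ Transcendental k t)
    (hs : s ≠ 0 ∧ s ≠ 1 ∧ s ≠ -1) {D₁ D₂ E : PrimeCurve k} (hne : D₁ ≠ D₂) (hG₁ : G ∈ D₁.ideal)
    (hG₂ : G ∈ D₂.ideal) (hD₁ : D₁.Through (polarPoint m (s - 1) t))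
    (hD₂ : D₂.Through (polarPoint m (s + 1) t)) (hE : E.Through (polarPoint m s t))
    (hEmem : E ∈ cycleComponents (properConchoid (centralConic a b c e) G))
    (hs2 : s + 2 = 0 ∨ s + 2 = 1 ∨ s + 2 = -1) : False := by
  have hδ : G.totalDegree = δ := hG.totalDegree hG0
  have hst₁ : Transcendental k (s - 1) ∨ Transcendental k t := by
    simpa [sub_eq_add_neg] using transcendental_add_intCast hst (-1)
  have hst₂ : Transcendental k (s + 1) ∨ Transcendental k t := by
    simpa using transcendental_add_intCast hst 1
  have hst₃ : Transcendental k (s - 2) ∨ Transcendental k t := by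
    simpa [sub_eq_add_neg] using transcendental_add_intCast hst (-2)
  have he' : algebraMap k Ω e ≠ 0 := (map_ne_zero _).2 he
  have ht' : t ^ 2 ≠ 0 := pow_ne_zero 2 ht
  have cast : ∀ n : ℕ, (n : k) ≠ 0 → (n : Ω) ≠ 0 := by
    intro n hn h
    apply hn
    apply (algebraMap k Ω).injective
    simpa using h
  have h2' : (2 : Ω) ≠ 0 := by simpa using cast 2 (by simpa using h2)
  have next : s - 2 ≠ 0 ∧ s - 2 ≠ 1 ∧ s - 2 ≠ -1 → E.Through (polarPoint m (s - 2) t) := by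
    intro h
    obtain ⟨E', hE', hE't⟩ := hm.exists_mem_cycleComponents hdisc he hG hG0 ht hst₃ h (s := s - 1)
      (by ring) hG₁ hD₁
    rwa [hsub hEmem hE']
  -- The radii of D₁, E, D₂ are -3, -2, -1 or -4, -3, -2. Outside characteristic 5, translating D₁
  -- the other way puts radius -4 or -5 on the conic E, and 16 - 4 = 12 or 25 - 9 = 16 would vanish.
  have hcases : s = -2 ∨ s = -3 := by
    rcases hs2 with h | h | h
    · left; linear_combination h
    · exact absurd (by linear_combination h) hs.2.2
    · right; linear_combination h
  rcases hcases with rfl | rfl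
  · have hD₂' := hm.ideal_eq_span_of_intCast he (r := -1) (by simp) (by push_cast; ring) hst₂ hD₂
    have h3' : (3 : k) ≠ 0 := by
      intro h
      have h6 := three_le_totalDegree hne (by simpa using he) hD₂' hG₁ hG₂ hG0
      have h7 := h3 h
      omega
    have h3Ω : (3 : Ω) ≠ 0 := by simpa using cast 3 (by simpa using h3')
    have hD₁' := hm.ideal_eq_span_of_intCast he (r := -3) (by simpa using h3') (by push_cast; ring)
      hst₁ hD₁
    have hE' := hm.ideal_eq_span_of_intCast he (r := -2) (by simpa using h2) (by push_cast; ring)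
      hst hE
    by_cases h5' : (5 : k) = 0
    · obtain ⟨hδ5, hnot⟩ := h5 h5'
      apply hnot
      -- In characteristic 5 the squared radii 9 and 1 are 4 and 1, so C is B + B₂.
      have e1 : ((-3 : ℤ) : k) ^ 2 * e = 4 * e := by push_cast; linear_combination e * h5'
      have e2 : ((-1 : ℤ) : k) ^ 2 * e = e := by push_cast; ring
      rw [e1] at hD₁'
      rw [e2] at hD₂'
      refine associated_mul_of_totalDegree_le hne.symm he ?_ hD₂' hD₁' hG₂ hG₁ hG0 (by omega)
      rw [← e1]
      exact mul_ne_zero (pow_ne_zero 2 (by simpa using h3')) he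
    · have h5Ω : (5 : Ω) ≠ 0 := by simpa using cast 5 (by simpa using h5')
      have h8 := next ⟨fun h => mul_ne_zero h2' h2' (by linear_combination -h),
        fun h => h5Ω (by linear_combination -h), fun h => h3Ω (by linear_combination -h)⟩
      have h9 := h8 _ (hE' ▸ Ideal.mem_span_singleton_self _)
      rw [hm.aeval_centralConic_polarPoint] at h9
      simp only [map_mul, map_pow, map_intCast] at h9
      push_cast at h9
      exact mul_ne_zero (mul_ne_zero (mul_ne_zero (mul_ne_zero h2' h2') h3Ω) he') ht'
        (by linear_combination h9)
  · have h3Ω : (3 : Ω) ≠ 0 := fun h => hs.1 (by linear_combination -h)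
    have h3' : (3 : k) ≠ 0 := by
      intro h
      have := congrArg (algebraMap k Ω) h
      simp only [map_ofNat, map_zero] at this
      exact h3Ω this
    have h4' : (4 : k) ≠ 0 := fun h => mul_ne_zero h2 h2 (by linear_combination h)
    have hD₂' := hm.ideal_eq_span_of_intCast he (r := -2) (by simpa using h2) (by push_cast; ring)
      hst₂ hD₂
    have hD₁' := hm.ideal_eq_span_of_intCast he (r := -4) (by simpa using h4') (by push_cast; ring)
      hst₁ hD₁
    have hE' := hm.ideal_eq_span_of_intCast he (r := -3) (by simpa using h3') (by push_cast; ring)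
      hst hE
    by_cases h5' : (5 : k) = 0
    · obtain ⟨hδ5, hnot⟩ := h5 h5'
      apply hnot
      have e1 : ((-4 : ℤ) : k) ^ 2 * e = e := by push_cast; linear_combination 3 * e * h5'
      have e2 : ((-2 : ℤ) : k) ^ 2 * e = 4 * e := by push_cast; ring
      rw [e1] at hD₁'
      rw [e2] at hD₂'
      exact associated_mul_of_totalDegree_le hne he (mul_ne_zero h4' he) hD₁' hD₂' hG₁ hG₂ hG0
        (by omega)
    · have h5Ω : (5 : Ω) ≠ 0 := by simpa using cast 5 (by simpa using h5')
      have h8 := next ⟨fun h => h5Ω (by linear_combination -h),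
        fun h => mul_ne_zero h2' h3Ω (by linear_combination -h),
        fun h => mul_ne_zero h2' h2' (by linear_combination -h)⟩
      have h9 := h8 _ (hE' ▸ Ideal.mem_span_singleton_self _)
      rw [hm.aeval_centralConic_polarPoint] at h9
      simp only [map_mul, map_pow, map_intCast] at h9
      push_cast at h9
      exact mul_ne_zero (mul_ne_zero (mul_ne_zero (mul_ne_zero (mul_ne_zero h2' h2') h2') h2') he')
        ht' (by linear_combination h9)

theorem IsPolarFrame.false_of_through [Infinite k] {Ω : Type*} [Field Ω] [Algebra k Ω]
    (hm : IsPolarFrame a b c e m) (hdisc : b ^ 2 - 4 * a * c ≠ 0) (he : e ≠ 0)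
    {G : MvPolynomial (Fin 3) k} {δ : ℕ} (hG : G.IsHomogeneous δ) (hG0 : G ≠ 0) (h2 : (2 : k) ≠ 0)
    (h3 : (3 : k) = 0 → δ < 3)
    (h5 : (5 : k) = 0 →
      δ < 5 ∧ ¬ Associated G (centralConic a b c e * centralConic a b c (4 * e)))
    (hsub : (cycleComponents (properConchoid (centralConic a b c e) G)).Subsingleton)
    {s t : Ω} (ht : t ≠ 0) (hst : Transcendental k s ∨ Transcendental k t)
    (hs : s ≠ 0 ∧ s ≠ 1 ∧ s ≠ -1) {D₁ D₂ E : PrimeCurve k} (hne : D₁ ≠ D₂) (hG₁ : G ∈ D₁.ideal)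
    (hG₂ : G ∈ D₂.ideal) (hD₁ : D₁.Through (polarPoint m (s - 1) t))
    (hD₂ : D₂.Through (polarPoint m (s + 1) t)) (hE : E.Through (polarPoint m s t))
    (hEmem : E ∈ cycleComponents (properConchoid (centralConic a b c e) G)) : False := by
  have hst₂ : Transcendental k (s + 1) ∨ Transcendental k t := by
    simpa using transcendental_add_intCast hst 1
  have hw := hm.hasTranscendentalRatio hs.1 ht hst
  by_cases hplus : s + 2 = 0 ∨ s + 2 = 1 ∨ s + 2 = -1
  · exact hm.false_of_add_two hdisc he hG hG0 h2 h3 h5 hsub ht hst hs hne hG₁ hG₂ hD₁ hD₂ hE hEmem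
      hplus
  by_cases hminus : s - 2 = 0 ∨ s - 2 = 1 ∨ s - 2 = -1
  -- The change of sign (s, t) ↦ (-s, -t) exchanges the roles of D₁ and D₂.
  · have e1 : -(s + 1) = -s - 1 := by ring
    have e2 : -(s - 1) = -s + 1 := by ring
    refine hm.false_of_add_two hdisc he hG hG0 h2 h3 h5 hsub (neg_ne_zero.2 ht)
      (hst.imp (fun h h' => h (by simpa using h'.neg)) (fun h h' => h (by simpa using h'.neg)))
      ⟨neg_ne_zero.2 hs.1, fun h => hs.2.2 (by rw [← h, neg_neg]), fun h => hs.2.1 (neg_inj.1 h)⟩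
      hne.symm hG₂ hG₁ (e1 ▸ hD₂.neg_polarPoint) (e2 ▸ hD₁.neg_polarPoint) hE.neg_polarPoint hEmem ?_
    rcases hminus with h | h | h
    · left; linear_combination -h
    · right; right; linear_combination -h
    · right; left; linear_combination -h
  push Not at hplus hminus
  have hstp : Transcendental k (s + 2) ∨ Transcendental k t := by
    simpa using transcendental_add_intCast hst 2
  have hstm : Transcendental k (s - 2) ∨ Transcendental k t := by
    simpa [sub_eq_add_neg] using transcendental_add_intCast hst (-2)
  have hEp : E.Through (polarPoint m (s + 2) t) := by
    obtain ⟨E', hE', hE't⟩ := hm.exists_mem_cycleComponents hdisc he hG hG0 ht hstp hplus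
      (s := s + 1) (by ring) hG₂ hD₂
    rwa [hsub hEmem hE']
  have hEm : E.Through (polarPoint m (s - 2) t) := by
    obtain ⟨E', hE', hE't⟩ := hm.exists_mem_cycleComponents hdisc he hG hG0 ht hstm hminus
      (s := s - 1) (by ring) hG₁ hD₁
    rwa [hsub hEmem hE']
  have hs1 : s + 1 ≠ 0 := fun h => hs.2.2 (eq_neg_of_add_eq_zero_left h)
  suffices ∃ r : ℤ, (r = 2 ∨ r = -2 ∨ r = 4) ∧ PolarSpecializes k s t (s + r) t by
    obtain ⟨r, hr, h⟩ := this
    exact hne (hm.eq_of_polarSpecializes_add h2 hr hs1 ht hst₂ h hD₁ hD₂)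
  rcases hm.polarSpecializes_or hw hplus.1 ht hE hEp with h | h
  · exact ⟨2, by simp, by simpa using h⟩
  rcases hm.polarSpecializes_or hw hminus.1 ht hE hEm with h' | h'
  · exact ⟨-2, by simp, by simpa [sub_eq_add_neg] using h'⟩
  -- Composing the reflections s ↦ 2 - s and s ↦ -s - 2, which both change the sign of t, gives the
  -- translation by 4.
  · refine ⟨4, by simp, h'.trans ?_⟩
    have h6 := (h.add (-2)).neg
    have e1 : -(s + ((-2 : ℤ) : Ω)) = -(s - 2) := by push_cast; ring
    have e2 : -(-(s + 2) + ((-2 : ℤ) : Ω)) = s + ((4 : ℤ) : Ω) := by push_cast; ring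
    rwa [e1, e2, neg_neg] at h6

end Reducible

/-! ### The line at infinity and the conclusion -/

/-- If the line at infinity is a component of a curve, then it is a component of its proper
conchoid. -/
theorem exists_X_two_mem_of_mem_cycleComponents {k : Type*} [Field k] [Infinite k] {a b c e : k}
    (hdisc : b ^ 2 - 4 * a * c ≠ 0) (he : e ≠ 0) {G : MvPolynomial (Fin 3) k} {δ : ℕ}
    (hG : G.IsHomogeneous δ) (hG0 : G ≠ 0) {D : PrimeCurve k} (hGD : G ∈ D.ideal)
    (hX : X 2 ∈ D.ideal) :
    ∃ E ∈ cycleComponents (properConchoid (centralConic a b c e) G), X 2 ∈ E.ideal := by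
  rw [D.ideal_eq_span_of_totalDegree_le_one hX (X_ne_zero _) (totalDegree_X _).le,
    Ideal.mem_span_singleton] at hGD
  obtain ⟨U, hU⟩ := hGD
  -- The generic point of the line at infinity corresponds to itself, both sides of the incidence
  -- equation being zero.
  let w : Fin 3 → RatFunc k := ![RatFunc.X, 1, 0]
  have hw : HasTranscendentalRatio k w :=
    ⟨0, 1, by simp [w], by simpa [w] using RatFunc.transcendental_X⟩
  have hq : binaryForm a b c (w 0) (w 1) ≠ 0 := by
    intro h
    have h1 : Polynomial.C a * Polynomial.X ^ 2 + Polynomial.C b * Polynomial.X +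
        Polynomial.C c = 0 := by
      apply (transcendental_iff.1 (RatFunc.transcendental_X (K := k)))
      simpa [binaryForm, w] using h
    have h0 := congrArg (fun p => Polynomial.coeff p 0) h1
    have h1' := congrArg (fun p => Polynomial.coeff p 1) h1
    simp [Polynomial.coeff_X, Polynomial.coeff_C] at h0 h1'
    simp [h0, h1'] at hdisc
  obtain ⟨E, hE, hE0⟩ := exists_through_conchoid_ne_zero hdisc he hG hG0
    (v := w) (fun h => by simpa [w] using congrFun h 1) hw
    (by constructor <;> simp [w, binaryForm]) (by simp [hU, w]) (Or.inr (by simp [w])) (Or.inl hq)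
  refine ⟨E, ?_, hE.mem hw (isHomogeneous_X k 2) (by simp [w])⟩
  rw [cycleComponents, Set.mem_ofPred_eq, properConchoid, if_neg]
  · exact hE0
  · rintro (h | h)
    · have h1 := hE _ (h ▸ Ideal.mem_span_singleton_self _)
      rw [aeval_centralConic] at h1
      exact hq (by simpa [w] using h1)
    · exact hq (h.binaryForm_eq_zero hE)

/-- Polar coordinates of a generic point can be chosen such that the translation of the radius by `1`
gives a component of the proper conchoid. -/
theorem IsPolarFrame.exists_through_polarPoint_sub_one.{u} {k : Type u} [Field k] [IsAlgClosed k]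
    {a b c e : k} {m : Matrix (Fin 2) (Fin 2) k} (hm : IsPolarFrame a b c e m) (he : e ≠ 0)
    (h2 : (2 : k) ≠ 0) {D : PrimeCurve k} (hX : X 2 ∉ D.ideal)
    (hD : ¬ IsAsymptoticLine (centralConic a b c e) D)
    (h3 : (3 : k) = 0 → D.ideal ≠ Ideal.span {centralConic a b c e}) :
    ∃ (Ω : Type u) (_ : Field Ω) (_ : Algebra k Ω) (s t : Ω), t ≠ 0 ∧
      (Transcendental k s ∨ Transcendental k t) ∧ (s ≠ 0 ∧ s ≠ 1 ∧ s ≠ -1) ∧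
      D.Through (polarPoint m (s - 1) t) := by
  obtain ⟨Ω, _, _, s, t, hs, ht, hst, hDt⟩ := hm.exists_through_polarPoint he hX hD
  have hst₁ : Transcendental k (s + 1) ∨ Transcendental k t := by
    simpa using transcendental_add_intCast hst 1
  have hst₂ : Transcendental k (s - 1) ∨ Transcendental k t := by
    simpa [sub_eq_add_neg] using transcendental_add_intCast hst (-1)
  by_cases hplus : s + 1 = 0 ∨ s + 1 = 1 ∨ s + 1 = -1
  · by_cases hminus : s - 1 = 0 ∨ s - 1 = 1 ∨ s - 1 = -1
    -- If neither sign of the radius works, the characteristic is 3 and s = ±1, so `D` is B.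
    · exfalso
      have hinj := (algebraMap k Ω).injective
      have h2' : (2 : Ω) ≠ 0 := fun h => h2 (hinj (by rwa [map_ofNat, map_zero]))
      have key : (3 : Ω) = 0 ∧ (s = 1 ∨ s = -1) := by
        rcases hplus with h | h | h
        · rcases hminus with h' | h' | h'
          · exact absurd (by linear_combination h - h') h2'
          · exact ⟨by linear_combination h - h', Or.inr (by linear_combination h)⟩
          · exact absurd (by linear_combination h') hs
        · exact absurd (by linear_combination h) hs
        · rcases hminus with h' | h' | h'
          · exact ⟨by linear_combination h - h', Or.inl (by linear_combination h')⟩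
          · exact absurd (by linear_combination h - h') (mul_ne_zero h2' h2')
          · exact absurd (by linear_combination h') hs
      refine h3 (hinj (by rw [map_ofNat, map_zero]; exact key.1)) ?_
      rcases key.2 with h | h
      · simpa using hm.ideal_eq_span_of_intCast he (r := 1) (by simp) (by simpa using h) hst hDt
      · simpa using hm.ideal_eq_span_of_intCast he (r := -1) (by simp) (by simpa using h) hst hDt
    · push Not at hminus
      refine ⟨Ω, _, _, -(s - 1), -t, neg_ne_zero.2 ht,
        hst₂.imp (fun h h' => h (by simpa using h'.neg)) (fun h h' => h (by simpa using h'.neg)),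
        ⟨neg_ne_zero.2 hminus.1, fun h => hminus.2.2 (neg_eq_iff_eq_neg.1 h),
          fun h => hminus.2.1 (neg_inj.1 h)⟩, ?_⟩
      have e1 : -(s - 1) - 1 = -s := by ring
      exact e1 ▸ hDt.neg_polarPoint
  · push Not at hplus
    refine ⟨Ω, _, _, s + 1, t, ht, hst₁, hplus, ?_⟩
    rwa [add_sub_cancel_right]

theorem not_X_two_mem_ideal_of_through {k Ω : Type*} [Field k] [Field Ω] [Algebra k Ω]
    {m : Matrix (Fin 2) (Fin 2) k} {D : PrimeCurve k} {s t : Ω} (ht : t ≠ 0)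
    (hD : D.Through (polarPoint m s t)) : X 2 ∉ D.ideal := by
  intro h
  have := hD _ h
  rw [aeval_X, polarPoint_two] at this
  exact ht this

theorem mainTheorem9 {k : Type*} [Field k] [IsAlgClosed k] (a b c e : k)
    (hdisc : b ^ 2 - 4 * a * c ≠ 0) (he : e ≠ 0)
    (δ : ℕ) (G : MvPolynomial (Fin 3) k) (hG : G.IsHomogeneous δ) (hG0 : G ≠ 0)
    (hchar : ringChar k = 0 ∨ max 2 δ < ringChar k)
    (hfive : ringChar k = 5 →
      ¬ Associated G (centralConic a b c e * centralConic a b c (4 * e)))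
    (hC : {D ∈ curveComponents G | ¬ IsAsymptoticLine (centralConic a b c e) D}.Nontrivial) :
    (cycleComponents (properConchoid (centralConic a b c e) G)).Nontrivial := by
  have hinf : Infinite k := IsAlgClosed.instInfinite
  have hprime : ∀ p : ℕ, p.Prime → (p : k) = 0 → ringChar k = p ∧ max 2 δ < p := by
    intro p hp h
    have h1 : ringChar k = p := ((Nat.dvd_prime hp).1 (ringChar.dvd h)).resolve_left
      CharP.ringChar_ne_one
    refine ⟨h1, ?_⟩
    rcases hchar with h0 | h0
    · exact absurd (h1.symm.trans h0) hp.ne_zero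
    · rwa [h1] at h0
  have h2 : (2 : k) ≠ 0 := by
    intro h
    have := (hprime 2 Nat.prime_two (by simpa using h)).2
    omega
  have h3 : (3 : k) = 0 → δ < 3 := by
    intro h
    have := (hprime 3 Nat.prime_three (by simpa using h)).2
    omega
  have h5 : (5 : k) = 0 →
      δ < 5 ∧ ¬ Associated G (centralConic a b c e * centralConic a b c (4 * e)) := by
    intro h
    obtain ⟨h6, h7⟩ := hprime 5 Nat.prime_five (by simpa using h)
    exact ⟨by omega, hfive h6⟩
  obtain ⟨m, hm⟩ := exists_isPolarFrame h2 hdisc he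
  have hδ : G.totalDegree = δ := hG.totalDegree hG0
  by_contra hsub
  rw [Set.not_nontrivial_iff] at hsub
  obtain ⟨D₁, ⟨hG₁, hA₁⟩, D₂, ⟨hG₂, hA₂⟩, hne⟩ := hC
  have good : ∀ D D' : PrimeCurve k, D ≠ D' → G ∈ D.ideal → G ∈ D'.ideal → X 2 ∉ D.ideal →
      ¬ IsAsymptoticLine (centralConic a b c e) D → _ := fun D D' hDD' hGD hGD' hX hA =>
    -- In characteristic 3 the degree of C is at most 2, which leaves no room for B and another
    -- component.
    hm.exists_through_polarPoint_sub_one he h2 hX hA fun h h' => by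
      have h6 := three_le_totalDegree hDD'.symm he h' hGD' hGD hG0
      have h7 := h3 h
      omega
  have component : ∀ (D : PrimeCurve k), G ∈ D.ideal → ∀ (Ω : Type _) (_ : Field Ω)
      (_ : Algebra k Ω) (s t : Ω), t ≠ 0 → (Transcendental k s ∨ Transcendental k t) →
      (s ≠ 0 ∧ s ≠ 1 ∧ s ≠ -1) → D.Through (polarPoint m (s - 1) t) →
      ∃ E ∈ cycleComponents (properConchoid (centralConic a b c e) G),
        E.Through (polarPoint m s t) := by
    intro D hGD Ω _ _ s t ht hst hs hDt
    exact hm.exists_mem_cycleComponents hdisc he hG hG0 ht hst hs (by ring) hGD hDt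
  -- The line at infinity would reappear in the proper conchoid, next to a component from D' whose
  -- generic point has t ≠ 0.
  have infinity : ∀ D D' : PrimeCurve k, D ≠ D' → G ∈ D.ideal → G ∈ D'.ideal →
      ¬ IsAsymptoticLine (centralConic a b c e) D' → X 2 ∉ D.ideal := by
    intro D D' hDD' hGD hGD' hA' hX
    have hX' : X 2 ∉ D'.ideal := by
      intro hX'
      apply hDD'
      ext1
      rw [D.ideal_eq_span_of_totalDegree_le_one hX (X_ne_zero _) (totalDegree_X _).le,
        D'.ideal_eq_span_of_totalDegree_le_one hX' (X_ne_zero _) (totalDegree_X _).le]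
    obtain ⟨Ω, _, _, s, t, ht, hst, hs, hDt⟩ := good D' D hDD'.symm hGD' hGD hX' hA'
    obtain ⟨E, hE, hEt⟩ := component D' hGD' Ω _ _ s t ht hst hs hDt
    obtain ⟨E', hE', hXE⟩ := exists_X_two_mem_of_mem_cycleComponents hdisc he hG hG0 hGD hX
    rw [hsub hE' hE] at hXE
    exact not_X_two_mem_ideal_of_through ht hEt hXE
  obtain ⟨Ω, _, _, s, t, ht, hst, hs, hDt⟩ :=
    good D₁ D₂ hne hG₁ hG₂ (infinity D₁ D₂ hne hG₁ hG₂ hA₂) hA₁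
  obtain ⟨Ω', _, _, s', t', ht', hst', hs', hDt'⟩ :=
    good D₂ D₁ hne.symm hG₂ hG₁ (infinity D₂ D₁ hne.symm hG₂ hG₁ hA₁) hA₂
  obtain ⟨E, hE, hEt⟩ := component D₁ hG₁ Ω _ _ s t ht hst hs hDt
  obtain ⟨E', hE', hEt'⟩ := component D₂ hG₂ Ω' _ _ s' t' ht' hst' hs' hDt'
  obtain rfl := hsub hE hE'
  have e1 : s' + ((-1 : ℤ) : Ω') = s' - 1 := by push_cast; ring
  rcases hm.polarSpecializes_or (hm.hasTranscendentalRatio hs'.1 ht' hst') hs.1 ht hEt' hEt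
    with h | h
  -- Equal signs: D₂ also passes through (s - 1, t), a generic point of D₁.
  · have h6 := h.add (-1)
    have e2 : s + ((-1 : ℤ) : Ω) = s - 1 := by push_cast; ring
    rw [e1, e2] at h6
    by_cases hs1 : s - 1 = 0
    · exact hs.2.1 (sub_eq_zero.1 hs1)
    have hst₁ : Transcendental k (s - 1) ∨ Transcendental k t := by
      simpa [sub_eq_add_neg] using transcendental_add_intCast hst (-1)
    exact hne (hDt.eq (h6.through hDt') (hm.hasTranscendentalRatio hs1 ht hst₁))
  -- Opposite signs: D₂ passes through (-s - 1, -t), which is the point (s + 1, t).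
  · have h6 := h.add (-1)
    have e2 : -s + ((-1 : ℤ) : Ω) = -(s + 1) := by push_cast; ring
    rw [e1, e2] at h6
    have h7 := (h6.through hDt').neg_polarPoint
    rw [neg_neg, neg_neg] at h7
    exact hm.false_of_through hdisc he hG hG0 h2 h3 h5 hsub ht hst hs hne hG₁ hG₂ hDt h7 hEt hE
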